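/- For $N\ge 1$, an $N$ complex Wigner matrix (a matrix of the Gaussian Unitary Ensemble $\mathrm{GUE}_N$) is a random $N\times N$ complex Hermitian matrix $X$ such that the real random variables $X_{i,i}$ $(1\le i\le N)$, $\sqrt2\,\mathrm{Re}(X_{i,j})$ and $\sqrt2\,\mathrm{Im}(X_{i,j})$ $(1\le i<j\le N)$ are independent with law $\mathcal N(0,1)$. Let $(M_N)_{N\ge1}$ be a sequence of random matrices defined on a common probability space such that, for every $N\ge1$, $M_N$ is an $N$ complex Wigner matrix. Let $\lambda_1^N,\dots,\lambda_N^N\in\mathbb R$ be the eigenvalues of $M_N$, counted with multiplicity, and let $$\mu_N=\frac1N\sum_{k=1}^N\delta_{\lambda_k^N/\sqrt N}$$ be the empirical distribution of the eigenvalues of $M_N/\sqrt N$. Then for every bounded continuous function $f:\mathbb R\to\mathbb R$, the random variable $\int_{\mathbb R} f\,d\mu_N$ is integrable for every $N\ge 1$, and $$\mathbb E\left[\int_{\mathbb R} f\,d\mu_N\right]\xrightarrow[N\to+\infty]{}\int_{\mathbb R} f\,d\sigma,$$ where $\sigma$ is the Wigner semicircle distribution, that is, the measure on $\mathbb R$ with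 density $x\mapsto\frac{\sqrt{4-x^2}}{2\pi}\,\mathbf 1_{[-2,2]}(x)$ with respect to the Lebesgue measure. -/

import Mathlib

open MeasureTheory ProbabilityTheory Filter Topology
open scoped ENNReal NNReal BoundedContinuousFunction

/-- The space of `N × N` complex Hermitian matrices. -/
abbrev HermitianMatrix (N : ℕ) : Type :=
  {A : Matrix (Fin N) (Fin N) ℂ // A.IsHermitian}

/-- The pairs `(i, j)` of indices with `i < j`. -/
abbrev UpperPair (N : ℕ) : Type :=
  {p : Fin N × Fin N // p.1 < p.2}

/-- The normalised real coordinates of a Hermitian matrix: the diagonal entries `A i i`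
(which are real), and `√2 * Re (A i j)`, `√2 * Im (A i j)` for `i < j`. -/
noncomputable def wignerCoord {N : ℕ} (A : HermitianMatrix N) :
    Fin N ⊕ UpperPair N ⊕ UpperPair N → ℝ
  | Sum.inl i => (A.1 i i).re
  | Sum.inr (Sum.inl p) => √2 * (A.1 p.1.1 p.1.2).re
  | Sum.inr (Sum.inr p) => √2 * (A.1 p.1.1 p.1.2).im

/-- `X` is an `N` complex Wigner matrix (`X ∼ GUE_N`): a random Hermitian matrix whose
normalised real coordinates are independent standard Gaussian random variables. -/
structure IsComplexWigner {Ω : Type*} [MeasurableSpace Ω] {N : ℕ}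
    (X : Ω → HermitianMatrix N) (P : Measure Ω) : Prop where
  hasLaw : ∀ c, HasLaw (fun ω => wignerCoord (X ω) c) (gaussianReal 0 1) P
  indep : iIndepFun (fun c ω => wignerCoord (X ω) c) P

/-- The empirical distribution `(1 / N) ∑ k, δ_{λ k / √N}` of the eigenvalues `λ k` of `A`,
counted with multiplicity and rescaled by `1 / √N`. -/
noncomputable def empiricalSpectralMeasure {N : ℕ} (A : HermitianMatrix N) : Measure ℝ :=
  (N : ℝ≥0∞)⁻¹ • ∑ k : Fin N, Measure.dirac (A.2.eigenvalues k / √(N : ℝ))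

/-- The Wigner semicircle distribution, with density `√(4 - x²) / (2π)` on `[-2, 2]`. -/
noncomputable def semicircleMeasure : Measure ℝ :=
  volume.withDensity fun x =>
    ENNReal.ofReal ((Set.Icc (-2 : ℝ) 2).indicator (fun y => √(4 - y ^ 2) / (2 * Real.pi)) x)

/-! The proof follows the Stieltjes transform. For Im z > 0 put G = (z - M_N/√N)⁻¹ and m = N⁻¹ tr G,
the Stieltjes transform of the empirical measure. Pointwise convergence of E m(z) gives weak
convergence of the mean empirical measures (`tendsto_of_tendsto_integral_inv_sub`). The transform of
the semicircle law is the root s of s² - z s + 1 = 0 with |s| < 1, and then Im s ≤ 0.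

Write M_N = ∑ x_c E_c, with E_c an orthonormal basis of the Hermitian matrices and x_c independent
standard Gaussians. The trace of (z - M_N/√N) G = 1 reads z m - 1 = N^(-3/2) ∑ x_c tr(E_c G).
Gaussian integration by parts and the completeness relation for E_c turn the right side into m², in
mean.

No separate concentration estimate is needed: the identity is tested against the conjugate of the
defect D = z m - 1 - m² itself. The m² terms cancel and only the derivative of the conjugate of D
survives, so that E|D|² = N⁻³ E[conj(z - 2m) tr(G (G²)*)] = O(N⁻²)
(`integral_defect_mul_conj_defect`). Since Im m and Im s are both nonpositive, |m - s| ≤ |D| / Im z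
for every realisation, hence E m → s. -/

/-! ### Stein's identity in one variable. -/

lemma hasDerivAt_gaussianPDFReal_zero_one (x : ℝ) :
    HasDerivAt (gaussianPDFReal 0 1) (-x * gaussianPDFReal 0 1 x) x := by
  have h : HasDerivAt (fun y : ℝ => -(y ^ 2) / 2) (-x) x := by
    have := ((hasDerivAt_pow 2 x).neg).div_const 2
    convert! this using 1
    push_cast
    ring
  have h2 := h.exp.const_mul (√(2 * Real.pi))⁻¹
  have e : gaussianPDFReal 0 1 = fun y : ℝ => (√(2 * Real.pi))⁻¹ * Real.exp (-(y ^ 2) / 2) := by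
    ext y; simp [gaussianPDFReal]
  rw [e]
  refine h2.congr_deriv ?_
  ring

lemma integral_gaussianReal_zero_one (g : ℝ → ℂ) :
    ∫ x, g x ∂(gaussianReal 0 1) = ∫ x, g x * (gaussianPDFReal 0 1 x : ℂ) := by
  rw [integral_gaussianReal_eq_integral_smul one_ne_zero]
  simp [Complex.real_smul, mul_comm]

lemma integrable_gaussianReal_zero_one_iff (g : ℝ → ℂ) :
    Integrable g (gaussianReal 0 1) ↔
      Integrable (fun x => g x * (gaussianPDFReal 0 1 x : ℂ)) := by
  rw [gaussianReal_of_var_ne_zero _ one_ne_zero,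
    integrable_withDensity_iff_integrable_smul' (measurable_gaussianPDF 0 1)
      (by simp [gaussianPDF])]
  simp [gaussianPDF, ENNReal.toReal_ofReal (gaussianPDFReal_nonneg 0 1 _), Complex.real_smul,
    mul_comm]

lemma integrable_ofReal_gaussianReal : Integrable (fun x : ℝ => (x : ℂ)) (gaussianReal 0 1) := by
  have h : Integrable (fun x : ℝ => x) (gaussianReal 0 1) :=
    (memLp_id_gaussianReal (μ := 0) (v := 1) 1).integrable (by norm_num)
  exact h.ofReal

/-- **Stein's identity** for the standard Gaussian distribution. -/
lemma integral_mul_gaussianReal_eq_integral_deriv {f f' : ℝ → ℂ} {C : ℝ}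
    (hf : ∀ x, HasDerivAt f (f' x) x) (hfC : ∀ x, ‖f x‖ ≤ C) (hf'C : ∀ x, ‖f' x‖ ≤ C) :
    ∫ x, (x : ℂ) * f x ∂(gaussianReal 0 1) = ∫ x, f' x ∂(gaussianReal 0 1) := by
  have hfm : Measurable f :=
    (continuous_iff_continuousAt.2 fun x => (hf x).continuousAt).measurable
  have hf'm : Measurable f' := by
    rw [show f' = deriv f from funext fun x => (hf x).deriv.symm]
    exact measurable_deriv f
  have i1 : Integrable f (gaussianReal 0 1) :=
    .of_bound hfm.aestronglyMeasurable C (.of_forall hfC)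
  have i2 : Integrable f' (gaussianReal 0 1) :=
    .of_bound hf'm.aestronglyMeasurable C (.of_forall hf'C)
  have i3 : Integrable (fun x : ℝ => (x : ℂ) * f x) (gaussianReal 0 1) := by
    simpa [mul_comm] using integrable_ofReal_gaussianReal.bdd_mul hfm.aestronglyMeasurable
      (.of_forall hfC)
  rw [integrable_gaussianReal_zero_one_iff] at i1 i2 i3
  rw [integral_gaussianReal_zero_one, integral_gaussianReal_zero_one]
  -- The Gaussian density satisfies φ' = -x φ, so integrating f φ' by parts moves the factor x onto
  -- a derivative of f.
  have key := integral_mul_deriv_eq_deriv_mul_of_integrable (u := f) (u' := f')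
    (v := fun x => (gaussianPDFReal 0 1 x : ℂ))
    (v' := fun x => ((-x * gaussianPDFReal 0 1 x : ℝ) : ℂ))
    (fun x _ => hf x) (fun x _ => (hasDerivAt_gaussianPDFReal_zero_one x).ofReal_comp)
    (by
      refine i3.neg.congr (.of_forall fun x => ?_)
      simp only [Pi.neg_apply, Pi.mul_apply]
      push_cast
      ring) i2 i1
  rw [← neg_eq_iff_eq_neg, ← integral_neg] at key
  rw [← key]
  congr 1 with x
  push_cast
  ring

/-! ### Gaussian integration by parts on a finite product. -/

section Pi

variable {ι : Type*} [Fintype ι] [DecidableEq ι]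

omit [Fintype ι] in
lemma measurable_update_prod (c : ι) :
    Measurable (fun p : (ι → ℝ) × ℝ => Function.update p.1 c p.2) := by
  refine measurable_pi_iff.2 fun i => ?_
  by_cases h : i = c
  · subst h; simpa using measurable_snd
  · simp only [Function.update_of_ne h]
    exact (measurable_pi_apply i).comp measurable_fst

/-- Resampling one coordinate preserves a product of probability measures. -/
lemma map_update_prod_pi (μ : ι → Measure ℝ) [∀ i, IsProbabilityMeasure (μ i)] (c : ι) :
    Measure.map (fun p : (ι → ℝ) × ℝ => Function.update p.1 c p.2)
      ((Measure.pi μ).prod (μ c)) = Measure.pi μ := by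
  have hm := measurable_update_prod c
  symm
  refine Measure.pi_eq fun s hs => ?_
  rw [Measure.map_apply hm (MeasurableSet.univ_pi hs)]
  -- The preimage of a box is a box: side `c` is freed, contributing a factor 1, and its constraint
  -- passes to the resampled coordinate.
  have : (fun p : (ι → ℝ) × ℝ => Function.update p.1 c p.2) ⁻¹' (Set.univ.pi s) =
      (Set.univ.pi (Function.update s c Set.univ)) ×ˢ (s c) := by
    ext ⟨x, t⟩
    simp only [Set.mem_preimage, Set.mem_pi, Set.mem_univ, true_imp_iff, Set.mem_prod]
    constructor
    · intro h
      refine ⟨fun i => ?_, by simpa using h c⟩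
      by_cases hi : i = c
      · subst hi; simp
      · simpa [Function.update_of_ne hi] using h i
    · rintro ⟨h1, h2⟩ i
      by_cases hi : i = c
      · subst hi; simpa using h2
      · simpa [Function.update_of_ne hi] using h1 i
  rw [this, Measure.prod_prod, Measure.pi_pi, ← Finset.mul_prod_erase _ _ (Finset.mem_univ c),
    ← Finset.mul_prod_erase Finset.univ (fun i => μ i (s i)) (Finset.mem_univ c)]
  simp only [Function.update_self, measure_univ, one_mul]
  rw [mul_comm]
  congr 1
  refine Finset.prod_congr rfl fun i hi => ?_
  rw [Function.update_of_ne (Finset.ne_of_mem_erase hi)]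

/-- Fubini in resampling form: it isolates one coordinate without splitting `ι → ℝ` as a product, so
a one-dimensional identity can be applied to the inner integral. -/
lemma integral_pi_eq_integral_update {μ : ι → Measure ℝ} [∀ i, IsProbabilityMeasure (μ i)]
    (c : ι) {F : (ι → ℝ) → ℂ} (hF : Integrable F (Measure.pi μ)) :
    ∫ x, F x ∂(Measure.pi μ) =
      ∫ x, ∫ t, F (Function.update x c t) ∂(μ c) ∂(Measure.pi μ) := by
  have hm := measurable_update_prod c
  have hF' : Integrable F (Measure.map (fun p : (ι → ℝ) × ℝ => Function.update p.1 c p.2)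
      ((Measure.pi μ).prod (μ c))) := by rwa [map_update_prod_pi]
  conv_lhs => rw [← map_update_prod_pi μ c]
  rw [integral_map hm.aemeasurable hF'.1, integral_prod]
  exact hF'.comp_measurable hm

/-- The standard Gaussian distribution on `ι → ℝ`. -/
noncomputable abbrev gaussianPi (ι : Type*) [Fintype ι] : Measure (ι → ℝ) :=
  Measure.pi fun _ => gaussianReal 0 1

omit [DecidableEq ι] in
lemma integrable_eval_gaussianPi (c : ι) :
    Integrable (fun x : ι → ℝ => (x c : ℂ)) (gaussianPi ι) :=
  (measurePreserving_eval (fun _ : ι => gaussianReal 0 1) c).integrable_comp_of_integrable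
    integrable_ofReal_gaussianReal

omit [DecidableEq ι] in
lemma integrable_gaussianPi_of_bound {F : (ι → ℝ) → ℂ} {C : ℝ} (hF : Measurable F)
    (hFC : ∀ x, ‖F x‖ ≤ C) : Integrable F (gaussianPi ι) :=
  .of_bound hF.aestronglyMeasurable C (.of_forall hFC)

omit [DecidableEq ι] in
lemma integrable_eval_mul_gaussianPi (c : ι) {F : (ι → ℝ) → ℂ} {C : ℝ} (hF : Measurable F)
    (hFC : ∀ x, ‖F x‖ ≤ C) : Integrable (fun x => (x c : ℂ) * F x) (gaussianPi ι) := by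
  simpa [mul_comm] using (integrable_eval_gaussianPi c).bdd_mul hF.aestronglyMeasurable
    (.of_forall hFC)

/-- Gaussian integration by parts in one coordinate. -/
lemma integral_eval_mul_gaussianPi (c : ι) {F F' : (ι → ℝ) → ℂ} {C : ℝ}
    (hF : Measurable F) (hF' : Measurable F')
    (hd : ∀ x, HasDerivAt (fun t => F (Function.update x c t)) (F' x) (x c))
    (hFC : ∀ x, ‖F x‖ ≤ C) (hF'C : ∀ x, ‖F' x‖ ≤ C) :
    ∫ x, (x c : ℂ) * F x ∂(gaussianPi ι) = ∫ x, F' x ∂(gaussianPi ι) := by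
  rw [integral_pi_eq_integral_update c (integrable_eval_mul_gaussianPi c hF hFC),
    integral_pi_eq_integral_update c (integrable_gaussianPi_of_bound hF' hF'C)]
  congr 1 with x
  simp only [Function.update_self]
  refine integral_mul_gaussianReal_eq_integral_deriv (C := C) (fun t => ?_)
    (fun t => hFC _) (fun t => hF'C _)
  simpa using hd (Function.update x c t)

end Pi

/-! ### An orthonormal basis of the Hermitian matrices and its contraction identities. -/

/-- The index set of the normalised real coordinates of a Hermitian matrix. -/
abbrev WignerIndex (N : ℕ) : Type := Fin N ⊕ UpperPair N ⊕ UpperPair N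

/-- The Hermitian matrices dual to the coordinates `wignerCoord`; they form an orthonormal basis
of the real inner product space of Hermitian matrices. -/
noncomputable def wignerBasis {N : ℕ} : WignerIndex N → Matrix (Fin N) (Fin N) ℂ
  | Sum.inl k => Matrix.of fun i j => if k = i ∧ k = j then 1 else 0
  | Sum.inr (Sum.inl p) => Matrix.of fun i j =>
      ((√2)⁻¹ : ℝ) * ((if p.1 = (i, j) then 1 else 0) + (if p.1 = (j, i) then 1 else 0))
  | Sum.inr (Sum.inr p) => Matrix.of fun i j =>
      ((√2)⁻¹ : ℝ) * Complex.I * ((if p.1 = (i, j) then 1 else 0) - (if p.1 = (j, i) then 1 else 0))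

lemma wignerBasis_isHermitian {N : ℕ} (c : WignerIndex N) : (wignerBasis c).IsHermitian := by
  ext i j
  rcases c with k | p | p
  · simp [wignerBasis, apply_ite (starRingEnd ℂ), and_comm]
  · simp [wignerBasis, apply_ite (starRingEnd ℂ), add_comm]
  · simp only [wignerBasis, Matrix.conjTranspose_apply, Matrix.of_apply, RCLike.star_def, map_mul,
      Complex.conj_ofReal, Complex.conj_I, map_sub, apply_ite (starRingEnd ℂ), map_one, map_zero]
    ring

/-- The Hermitian matrix with given coordinates. -/
noncomputable def wignerMatrix {N : ℕ} (x : WignerIndex N → ℝ) : Matrix (Fin N) (Fin N) ℂ :=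
  ∑ c, x c • wignerBasis c

lemma wignerMatrix_isHermitian {N : ℕ} (x : WignerIndex N → ℝ) :
    (wignerMatrix x).IsHermitian := by
  unfold wignerMatrix Matrix.IsHermitian
  rw [Matrix.conjTranspose_sum]
  refine Finset.sum_congr rfl fun c _ => ?_
  rw [Matrix.conjTranspose_smul, (wignerBasis_isHermitian c).eq, star_trivial]

lemma sum_upperPair_ite {N : ℕ} (f : Fin N × Fin N → ℂ) (i j : Fin N) :
    ∑ p : UpperPair N, (if p.1 = (i, j) then 1 else 0) * f p.1 =
      if i < j then f (i, j) else 0 := by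
  rw [← Finset.sum_subtype (Finset.univ.filter fun p : Fin N × Fin N => p.1 < p.2)
    (by simp) (fun p => (if p = (i, j) then 1 else 0) * f p), Finset.sum_filter]
  rw [Finset.sum_eq_single (i, j)]
  · simp
  · intro p _ hp; simp [hp]
  · simp

lemma inv_sqrt_two_mul_self : (((√2)⁻¹ : ℝ) : ℂ) * (((√2)⁻¹ : ℝ) : ℂ) = 1 / 2 := by
  rw [← Complex.ofReal_mul, ← mul_inv, Real.mul_self_sqrt (by norm_num)]
  norm_num

/-- Completeness relation for the basis of Hermitian matrices. -/
lemma sum_wignerBasis_mul_wignerBasis {N : ℕ} (i j k l : Fin N) :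
    ∑ c : WignerIndex N, wignerBasis c i j * wignerBasis c k l =
      if i = l ∧ j = k then 1 else 0 := by
  rw [Fintype.sum_sum_type, Fintype.sum_sum_type, ← Finset.sum_add_distrib]
  -- For each pair the symmetric and antisymmetric basis elements combine: because I² = -1, the
  -- products pairing (i, j) with (k, l) cancel and those pairing (i, j) with (l, k) double.
  have h1 : ∀ p : UpperPair N,
      wignerBasis (Sum.inr (Sum.inl p)) i j * wignerBasis (Sum.inr (Sum.inl p)) k l +
        wignerBasis (Sum.inr (Sum.inr p)) i j * wignerBasis (Sum.inr (Sum.inr p)) k l =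
      (if p.1 = (i, j) then 1 else 0) * (if p.1 = (l, k) then 1 else 0) +
        (if p.1 = (j, i) then 1 else 0) * (if p.1 = (k, l) then 1 else 0) := by
    intro p
    simp only [wignerBasis, Matrix.of_apply]
    rw [mul_mul_mul_comm, mul_mul_mul_comm (_ * Complex.I), mul_mul_mul_comm _ Complex.I,
      inv_sqrt_two_mul_self, Complex.I_mul_I]
    ring
  rw [Finset.sum_congr rfl fun p _ => h1 p, Finset.sum_add_distrib,
    sum_upperPair_ite (fun p => if p = (l, k) then 1 else 0),
    sum_upperPair_ite (fun p => if p = (k, l) then 1 else 0)]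
  clear h1
  have h2 : ∑ m : Fin N, wignerBasis (Sum.inl m) i j * wignerBasis (Sum.inl m) k l =
      if i = j ∧ i = k ∧ i = l then (1 : ℂ) else 0 := by
    rw [Finset.sum_eq_single i]
    · simp only [wignerBasis, Matrix.of_apply]
      grind
    · intro m _ hm; simp [wignerBasis, hm]
    · simp
  rw [h2]
  rcases lt_trichotomy i j with h | h | h
  · simp [h, h.ne, h.not_gt, Prod.ext_iff]
  · grind
  · simp [h, h.ne', h.not_gt, Prod.ext_iff, and_comm]

/-- Contracting two basis elements inside one trace splits it in two. With A = B = G this produces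
the main term m² of the loop equation. -/
lemma sum_trace_wignerBasis_mul_mul_mul {N : ℕ} (A B : Matrix (Fin N) (Fin N) ℂ) :
    ∑ c : WignerIndex N, (wignerBasis c * A * wignerBasis c * B).trace = A.trace * B.trace := by
  have h : ∀ c : WignerIndex N, (wignerBasis c * A * wignerBasis c * B).trace =
      ∑ i, ∑ l, ∑ k, ∑ j, (wignerBasis c i j * wignerBasis c k l) * (A j k * B l i) := by
    intro c
    simp only [Matrix.trace, Matrix.diag, Matrix.mul_apply, Finset.sum_mul]
    refine Finset.sum_congr rfl fun i _ => Finset.sum_congr rfl fun l _ =>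
      Finset.sum_congr rfl fun k _ => Finset.sum_congr rfl fun j _ => ?_
    ring
  simp_rw [h]
  simp_rw [Finset.sum_comm (s := (Finset.univ : Finset (WignerIndex N))), ← Finset.sum_mul,
    sum_wignerBasis_mul_wignerBasis, ite_and, ite_mul, one_mul, zero_mul]
  simp only [Finset.sum_ite_eq, Finset.sum_ite_eq', Finset.mem_univ, if_true,
    Finset.sum_ite_irrel, Finset.sum_const_zero]
  simp only [Matrix.trace, Matrix.diag, Finset.sum_mul_sum]
  exact Finset.sum_comm

/-- Contracting across two traces merges them. One trace fewer means one factor N fewer, which is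
why this term is only an error. -/
lemma sum_trace_wignerBasis_mul_mul_trace {N : ℕ} (A B : Matrix (Fin N) (Fin N) ℂ) :
    ∑ c : WignerIndex N, (wignerBasis c * A).trace * (wignerBasis c * B).trace =
      (A * B).trace := by
  have h : ∀ c : WignerIndex N, (wignerBasis c * A).trace * (wignerBasis c * B).trace =
      ∑ i, ∑ k, ∑ j, ∑ l, (wignerBasis c i j * wignerBasis c k l) * (A j i * B l k) := by
    intro c
    simp only [Matrix.trace, Matrix.diag, Matrix.mul_apply, Finset.sum_mul_sum]
    refine Finset.sum_congr rfl fun i _ => Finset.sum_congr rfl fun l _ =>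
      Finset.sum_congr rfl fun k _ => Finset.sum_congr rfl fun j _ => ?_
    ring
  simp_rw [h]
  simp_rw [Finset.sum_comm (s := (Finset.univ : Finset (WignerIndex N))), ← Finset.sum_mul,
    sum_wignerBasis_mul_wignerBasis, ite_and, ite_mul, one_mul, zero_mul]
  simp only [Finset.sum_ite_eq, Finset.sum_ite_eq', Finset.mem_univ, if_true]
  simp only [Matrix.trace, Matrix.diag, Matrix.mul_apply]
  exact Finset.sum_comm

lemma trace_wignerBasis_mul {N : ℕ} (A : HermitianMatrix N) (c : WignerIndex N) :
    (wignerBasis c * A.1).trace = wignerCoord A c := by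
  have hs : ∀ p : Fin N × Fin N, ∀ f : Fin N → Fin N → ℂ,
      ∑ i, ∑ j, (if p = (i, j) then 1 else 0) * f i j = f p.1 p.2 := by
    intro p f
    rw [← Fintype.sum_prod_type' (f := fun i j => (if p = (i, j) then 1 else 0) * f i j)]
    simp
  have hs' : ∀ p : Fin N × Fin N, ∀ f : Fin N → Fin N → ℂ,
      ∑ i, ∑ j, (if p = (j, i) then 1 else 0) * f i j = f p.2 p.1 := by
    intro p f
    rw [Finset.sum_comm]
    exact hs p fun j i => f i j
  have hA : ∀ i j, A.1 j i = starRingEnd ℂ (A.1 i j) := fun i j => (A.2.apply j i).symm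
  have h2 : (2 : ℂ) * ((√2)⁻¹ : ℝ) = (√2 : ℝ) := by
    rw [← Complex.ofReal_ofNat, ← Complex.ofReal_mul, ← div_eq_mul_inv, Real.div_sqrt]
  simp only [Matrix.trace, Matrix.diag, Matrix.mul_apply]
  rcases c with k | p | p
  · have hk : (A.1 k k).im = 0 := Complex.conj_eq_iff_im.1 (hA k k).symm
    simp only [wignerBasis, Matrix.of_apply, wignerCoord, ite_and, ite_mul, one_mul, zero_mul,
      Finset.sum_ite_irrel, Finset.sum_ite_eq, Finset.mem_univ, if_true, Finset.sum_const_zero]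
    apply Complex.ext <;> simp [hk]
  · simp only [wignerBasis, Matrix.of_apply, wignerCoord, mul_assoc, ← Finset.mul_sum, add_mul,
      Finset.sum_add_distrib]
    rw [hs _ fun i j => A.1 j i, hs' _ fun i j => A.1 j i, hA, Complex.ofReal_mul, ← h2,
      add_comm, Complex.add_conj]
    push_cast
    ring
  · simp only [wignerBasis, Matrix.of_apply, wignerCoord, mul_assoc, ← Finset.mul_sum, sub_mul,
      Finset.sum_sub_distrib]
    rw [hs _ fun i j => A.1 j i, hs' _ fun i j => A.1 j i, hA, Complex.ofReal_mul, ← h2,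
      ← neg_sub, Complex.sub_conj]
    push_cast
    linear_combination (-2 * ((√2 : ℝ) : ℂ)⁻¹ * (A.1 p.1.1 p.1.2).im) * Complex.I_mul_I

/-- The coordinates are the Hilbert–Schmidt coefficients tr(E_c A), so completeness rebuilds the
matrix from them. This allows the random matrix to be replaced by a Gaussian vector. -/
lemma wignerMatrix_wignerCoord {N : ℕ} (A : HermitianMatrix N) :
    wignerMatrix (wignerCoord A) = A.1 := by
  ext k l
  simp only [wignerMatrix, Matrix.sum_apply, Matrix.smul_apply, Complex.real_smul,
    ← trace_wignerBasis_mul]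
  simp only [Matrix.trace, Matrix.diag, Matrix.mul_apply, Finset.sum_mul]
  simp_rw [mul_right_comm, Finset.sum_comm (s := (Finset.univ : Finset (WignerIndex N))),
    ← Finset.sum_mul, sum_wignerBasis_mul_wignerBasis, ite_and, ite_mul, one_mul, zero_mul]
  simp

/-! ### Resolvents of Hermitian matrices. -/

section Resolvent

open scoped Matrix.Norms.L2Operator ComplexOrder

variable {n : Type*} [Fintype n] [DecidableEq n]

lemma Matrix.norm_trace_le (A : Matrix n n ℂ) : ‖A.trace‖ ≤ Fintype.card n * ‖A‖ := by
  refine (norm_sum_le _ _).trans ?_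
  refine (Finset.sum_le_card_nsmul _ _ ‖A‖ fun i _ => ?_).trans (by simp)
  have h := Matrix.l2_opNorm_mulVec A (EuclideanSpace.single i 1)
  rw [show ‖EuclideanSpace.single i (1 : ℂ)‖ = 1 by simp, mul_one] at h
  refine le_trans ?_ h
  have h2 := PiLp.norm_apply_le (WithLp.toLp 2 (A.mulVec (Pi.single i 1)) : EuclideanSpace ℂ n) i
  simpa using h2

/-- The resolvent `(z - A)⁻¹` of a matrix. -/
noncomputable def Matrix.resolvent (A : Matrix n n ℂ) (z : ℂ) : Matrix n n ℂ := (z • 1 - A)⁻¹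

variable {A : Matrix n n ℂ} {z : ℂ}

lemma Matrix.IsHermitian.isUnit_smul_one_sub (hA : A.IsHermitian) (hz : 0 < z.im) :
    IsUnit (z • 1 - A) := by
  have h : z ∉ spectrum ℂ A := fun h =>
    hz.ne' (IsSelfAdjoint.im_eq_zero_of_mem_spectrum hA.isSelfAdjoint h)
  rw [spectrum.notMem_iff, Algebra.algebraMap_eq_smul_one] at h
  exact h

lemma Matrix.IsHermitian.sub_mul_resolvent (hA : A.IsHermitian) (hz : 0 < z.im) :
    (z • 1 - A) * A.resolvent z = 1 :=
  Matrix.mul_nonsing_inv _ ((Matrix.isUnit_iff_isUnit_det _).1 (hA.isUnit_smul_one_sub hz))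

lemma Matrix.IsHermitian.resolvent_mul_sub (hA : A.IsHermitian) (hz : 0 < z.im) :
    A.resolvent z * (z • 1 - A) = 1 :=
  Matrix.nonsing_inv_mul _ ((Matrix.isUnit_iff_isUnit_det _).1 (hA.isUnit_smul_one_sub hz))

/-- The resolvent identity between z and its conjugate. Norms give the bound on G, and traces give
the sign of Im tr G. -/
lemma Matrix.IsHermitian.resolvent_sub_conjTranspose (hA : A.IsHermitian) (hz : 0 < z.im) :
    A.resolvent z - (A.resolvent z).conjTranspose =
      (-(2 * z.im * Complex.I)) • (A.resolvent z * (A.resolvent z).conjTranspose) := by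
  set G := A.resolvent z
  have h1 : G * (z • 1 - A) = 1 := hA.resolvent_mul_sub hz
  have h2 : (starRingEnd ℂ z • 1 - A) * G.conjTranspose = 1 := by
    have := congrArg Matrix.conjTranspose h1
    simpa [Matrix.conjTranspose_mul, hA.eq] using this
  calc G - G.conjTranspose
      = G * ((starRingEnd ℂ z • 1 - A) * G.conjTranspose)
        - (G * (z • 1 - A)) * G.conjTranspose := by rw [h1, h2, mul_one, one_mul]
    _ = (starRingEnd ℂ z - z) • (G * G.conjTranspose) := by
        simp only [mul_sub, sub_mul, mul_assoc, Algebra.mul_smul_comm, Algebra.smul_mul_assoc,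
          mul_one, one_mul, sub_smul]
        abel
    _ = _ := by
        rw [← neg_sub, Complex.sub_conj]
        push_cast
        rfl

/-- The resolvent identity and the C*-identity give 2 Im z ‖G‖² = ‖G - G*‖ ≤ 2‖G‖. -/
lemma Matrix.IsHermitian.norm_resolvent_le (hA : A.IsHermitian) (hz : 0 < z.im) :
    ‖A.resolvent z‖ ≤ (z.im)⁻¹ := by
  set G := A.resolvent z
  have h1 := congrArg norm (hA.resolvent_sub_conjTranspose hz)
  have h2 : ‖G * G.conjTranspose‖ = ‖G‖ * ‖G‖ := by
    have := Matrix.l2_opNorm_conjTranspose_mul_self G.conjTranspose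
    simpa [Matrix.l2_opNorm_conjTranspose] using this
  rw [norm_smul, h2] at h1
  have h3 : ‖-(2 * (z.im : ℂ) * Complex.I)‖ = 2 * z.im := by simp [abs_of_pos hz]
  rw [h3] at h1
  have h4 : ‖G - G.conjTranspose‖ ≤ 2 * ‖G‖ := by
    refine (norm_sub_le _ _).trans ?_
    rw [Matrix.l2_opNorm_conjTranspose]
    linarith
  rw [← one_div, le_div_iff₀ hz]
  by_contra! h
  have : 0 < ‖G‖ := by
    by_contra! h0
    nlinarith
  nlinarith

lemma Matrix.IsHermitian.im_trace_resolvent_nonpos (hA : A.IsHermitian) (hz : 0 < z.im) :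
    (A.resolvent z).trace.im ≤ 0 := by
  set G := A.resolvent z
  have h1 := congrArg (fun M => (Matrix.trace M).im) (hA.resolvent_sub_conjTranspose hz)
  have h2 : 0 ≤ (G * G.conjTranspose).trace :=
    (Matrix.posSemidef_self_mul_conjTranspose G).trace_nonneg
  rw [Complex.le_def] at h2
  simp only [Matrix.trace_sub, Matrix.trace_smul, Matrix.trace_conjTranspose, Complex.sub_im,
    RCLike.star_def, Complex.conj_im, smul_eq_mul, Complex.mul_im, Complex.neg_re,
    Complex.neg_im, Complex.mul_re] at h1
  simp at h1 h2
  change G.trace.im + G.trace.im = _ at h1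
  nlinarith [h2.1]

/-- The factor `r` is kept outside so that the eigenvalues are those of `A`, as in the empirical
measure, rather than those of `r • A`. -/
lemma Matrix.IsHermitian.trace_resolvent_smul (hA : A.IsHermitian) (hz : 0 < z.im) (r : ℝ) :
    ((r • A).resolvent z).trace = ∑ k, (z - (r * hA.eigenvalues k : ℝ))⁻¹ := by
  set φ := Unitary.conjStarAlgAut ℂ _ hA.eigenvectorUnitary
  have htr : ∀ D, (φ D).trace = D.trace := by
    intro D
    rw [Unitary.conjStarAlgAut_apply, Matrix.trace_mul_cycle]
    simp
  have hne : ∀ k, z - (r * hA.eigenvalues k : ℝ) ≠ 0 := fun k h => by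
    have := congrArg Complex.im h
    simp at this
    exact hz.ne' this
  have h1 : z • 1 - r • A =
      φ (Matrix.diagonal fun k => z - (r * hA.eigenvalues k : ℝ)) := by
    have : (Matrix.diagonal fun k => z - (r * hA.eigenvalues k : ℝ)) =
        z • 1 - (r : ℂ) • Matrix.diagonal (RCLike.ofReal ∘ hA.eigenvalues) := by
      rw [Matrix.smul_one_eq_diagonal, ← Matrix.diagonal_smul, Matrix.diagonal_sub]
      simp [Function.comp_def]
    rw [this, map_sub, map_smul, map_smul, map_one, ← hA.spectral_theorem]
    simp
  have h2 : (z • 1 - r • A)⁻¹ =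
      φ (Matrix.diagonal fun k => (z - (r * hA.eigenvalues k : ℝ))⁻¹) := by
    refine Matrix.inv_eq_right_inv ?_
    rw [h1, ← map_mul, Matrix.diagonal_mul_diagonal]
    simp only [mul_inv_cancel₀ (hne _), Matrix.diagonal_one]
    exact map_one φ
  rw [Matrix.resolvent, h2, htr, Matrix.trace_diagonal]

lemma HasDerivAt.matrix_inv {B : ℝ → Matrix n n ℂ} {B' : Matrix n n ℂ} {t : ℝ}
    (hB : HasDerivAt B B' t) (hu : IsUnit (B t)) :
    HasDerivAt (fun s => (B s)⁻¹) (-((B t)⁻¹ * B' * (B t)⁻¹)) t := by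
  obtain ⟨u, hu⟩ := hu
  have h := hasFDerivAt_ringInverse (𝕜 := ℝ) u
  rw [hu] at h
  have h2 := h.comp_hasDerivAt t hB
  simp only [Matrix.nonsing_inv_eq_ringInverse]
  refine h2.congr_deriv ?_
  rw [← hu, Ring.inverse_unit]
  simp

end Resolvent

/-! ### An algebra of test functions for integration by parts. -/

/-- Bounded measurable complex functions. -/
def IsBddMeasurable {α : Type*} [MeasurableSpace α] (F : α → ℂ) : Prop :=
  Measurable F ∧ ∃ C, ∀ x, ‖F x‖ ≤ C

namespace IsBddMeasurable

variable {α : Type*} [MeasurableSpace α] {F G : α → ℂ}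

lemma const (a : ℂ) : IsBddMeasurable fun _ : α => a := ⟨measurable_const, ‖a‖, fun _ => le_rfl⟩

lemma add (hF : IsBddMeasurable F) (hG : IsBddMeasurable G) :
    IsBddMeasurable fun x => F x + G x := by
  obtain ⟨hF, C, hC⟩ := hF
  obtain ⟨hG, D, hD⟩ := hG
  exact ⟨hF.add hG, C + D, fun x => (norm_add_le _ _).trans (add_le_add (hC x) (hD x))⟩

lemma sub (hF : IsBddMeasurable F) (hG : IsBddMeasurable G) :
    IsBddMeasurable fun x => F x - G x := by
  obtain ⟨hF, C, hC⟩ := hF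
  obtain ⟨hG, D, hD⟩ := hG
  exact ⟨hF.sub hG, C + D, fun x => (norm_sub_le _ _).trans (add_le_add (hC x) (hD x))⟩

lemma mul (hF : IsBddMeasurable F) (hG : IsBddMeasurable G) :
    IsBddMeasurable fun x => F x * G x := by
  obtain ⟨hF, C, hC⟩ := hF
  obtain ⟨hG, D, hD⟩ := hG
  refine ⟨hF.mul hG, C * D, fun x => ?_⟩
  rw [norm_mul]
  exact mul_le_mul (hC x) (hD x) (norm_nonneg _) ((norm_nonneg _).trans (hC x))

lemma conj (hF : IsBddMeasurable F) : IsBddMeasurable fun x => starRingEnd ℂ (F x) := by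
  obtain ⟨hF, C, hC⟩ := hF
  exact ⟨Complex.continuous_conj.measurable.comp hF, C, fun x => by simpa using hC x⟩

lemma integrable (hF : IsBddMeasurable F) {μ : Measure α} [IsFiniteMeasure μ] :
    Integrable F μ := by
  obtain ⟨hF, C, hC⟩ := hF
  exact .of_bound hF.aestronglyMeasurable C (.of_forall hC)

variable {ι : Type*} [Fintype ι] {H H' : (ι → ℝ) → ℂ}

lemma integrable_eval_mul (hH : IsBddMeasurable H) (c : ι) :
    Integrable (fun x => (x c : ℂ) * H x) (gaussianPi ι) := by
  obtain ⟨hH, C, hC⟩ := hH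
  exact integrable_eval_mul_gaussianPi c hH hC

lemma integral_eval_mul [DecidableEq ι] (hH : IsBddMeasurable H) (hH' : IsBddMeasurable H')
    (c : ι) (hd : ∀ x, HasDerivAt (fun t => H (Function.update x c t)) (H' x) (x c)) :
    ∫ x, (x c : ℂ) * H x ∂(gaussianPi ι) = ∫ x, H' x ∂(gaussianPi ι) := by
  obtain ⟨hH, C, hC⟩ := hH
  obtain ⟨hH', D, hD⟩ := hH'
  exact integral_eval_mul_gaussianPi (C := max C D) c hH hH' hd
    (fun x => (hC x).trans (le_max_left _ _)) (fun x => (hD x).trans (le_max_right _ _))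

end IsBddMeasurable

/-! ### The resolvent as a function of the Gaussian coordinates. -/

section WignerResolvent

open scoped Matrix.Norms.L2Operator

variable {N : ℕ} {z : ℂ}

/-- The resolvent of the rescaled Hermitian matrix with given coordinates. -/
noncomputable def wignerResolvent (z : ℂ) (x : WignerIndex N → ℝ) : Matrix (Fin N) (Fin N) ℂ :=
  ((√(N : ℝ))⁻¹ • wignerMatrix x).resolvent z

/-- The normalised trace of the resolvent of the rescaled Hermitian matrix. -/
noncomputable def wignerStieltjes (z : ℂ) (x : WignerIndex N → ℝ) : ℂ :=
  (N : ℂ)⁻¹ * (wignerResolvent z x).trace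

lemma isHermitian_smul_wignerMatrix (x : WignerIndex N → ℝ) (r : ℝ) :
    (r • wignerMatrix x).IsHermitian := by
  rw [Matrix.IsHermitian, Matrix.conjTranspose_smul, (wignerMatrix_isHermitian x).eq, star_trivial]

lemma norm_wignerResolvent_le (hz : 0 < z.im) (x : WignerIndex N → ℝ) :
    ‖wignerResolvent z x‖ ≤ (z.im)⁻¹ :=
  (isHermitian_smul_wignerMatrix x _).norm_resolvent_le hz

lemma continuous_wignerMatrix : Continuous (wignerMatrix (N := N)) := by
  unfold wignerMatrix
  fun_prop

lemma continuous_wignerResolvent (hz : 0 < z.im) : Continuous (wignerResolvent (N := N) z) := by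
  unfold wignerResolvent Matrix.resolvent
  simp only [Matrix.nonsing_inv_eq_ringInverse]
  refine continuous_iff_continuousAt.2 fun x => ?_
  obtain ⟨u, hu⟩ := (isHermitian_smul_wignerMatrix x (√(N : ℝ))⁻¹).isUnit_smul_one_sub hz
  have h1 := NormedRing.inverse_continuousAt u
  rw [hu] at h1
  refine ContinuousAt.comp (f := fun x : WignerIndex N → ℝ =>
    z • (1 : Matrix (Fin N) (Fin N) ℂ) - (√(N : ℝ))⁻¹ • wignerMatrix x) h1 ?_
  have := continuous_wignerMatrix (N := N)
  fun_prop

lemma wignerMatrix_update (x : WignerIndex N → ℝ) (c : WignerIndex N) (t : ℝ) :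
    wignerMatrix (Function.update x c t) = wignerMatrix x + (t - x c) • wignerBasis c := by
  have h : Function.update x c t = x + Pi.single c (t - x c) := by
    ext i
    by_cases hi : i = c
    · subst hi; simp
    · simp [hi]
  simp [wignerMatrix, h, add_smul, Finset.sum_add_distrib, Pi.single_apply, ite_smul]

lemma hasDerivAt_wignerResolvent_update (hz : 0 < z.im) (x : WignerIndex N → ℝ)
    (c : WignerIndex N) :
    HasDerivAt (fun t => wignerResolvent z (Function.update x c t))
      ((√(N : ℝ))⁻¹ • (wignerResolvent z x * wignerBasis c * wignerResolvent z x)) (x c) := by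
  have hB : HasDerivAt (fun t => z • (1 : Matrix (Fin N) (Fin N) ℂ) -
      (√(N : ℝ))⁻¹ • wignerMatrix (Function.update x c t)) (-((√(N : ℝ))⁻¹ • wignerBasis c))
      (x c) := by
    simp only [wignerMatrix_update]
    have h1 : HasDerivAt (fun t : ℝ => (t - x c) • wignerBasis c) (wignerBasis c) (x c) := by
      simpa using ((hasDerivAt_id (x c)).sub_const (x c)).smul_const (wignerBasis c)
    exact ((h1.const_add (wignerMatrix x)).const_smul (√(N : ℝ))⁻¹).const_sub _
  have hu := (isHermitian_smul_wignerMatrix x (√(N : ℝ))⁻¹).isUnit_smul_one_sub hz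
  have h := hB.matrix_inv (by simpa using hu)
  refine h.congr_deriv ?_
  simp [wignerResolvent, Matrix.resolvent]

lemma hasDerivAt_trace_mul_wignerResolvent_update (hz : 0 < z.im) (x : WignerIndex N → ℝ)
    (c : WignerIndex N) (B : Matrix (Fin N) (Fin N) ℂ) :
    HasDerivAt (fun t => (B * wignerResolvent z (Function.update x c t)).trace)
      (((√(N : ℝ))⁻¹ : ℝ) * (B * wignerResolvent z x * wignerBasis c * wignerResolvent z x).trace)
      (x c) := by
  have h := hasDerivAt_wignerResolvent_update hz x c
  let L : Matrix (Fin N) (Fin N) ℂ →ₗ[ℝ] ℂ :=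
    (Matrix.traceLinearMap (Fin N) ℝ ℂ).comp (LinearMap.mulLeft ℝ B)
  have h2 := L.toContinuousLinearMap.hasFDerivAt.comp_hasDerivAt (x c) h
  refine h2.congr_deriv ?_
  simp only [LinearMap.coe_toContinuousLinearMap', map_smul, Complex.real_smul]
  simp [L, mul_assoc]

lemma isBddMeasurable_trace_mul_wignerResolvent (hz : 0 < z.im)
    (B : Matrix (Fin N) (Fin N) ℂ) :
    IsBddMeasurable fun x => (B * wignerResolvent z x).trace := by
  have hc := continuous_wignerResolvent (N := N) hz
  refine ⟨(by fun_prop : Continuous _).measurable, N * (‖B‖ * (z.im)⁻¹), fun x => ?_⟩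
  refine (Matrix.norm_trace_le _).trans ?_
  rw [Fintype.card_fin]
  gcongr
  exact (norm_mul_le _ _).trans (by gcongr; exact norm_wignerResolvent_le hz x)

lemma wignerStieltjes_isBddMeasurable (hz : 0 < z.im) :
    IsBddMeasurable (wignerStieltjes (N := N) z) := by
  have h := (IsBddMeasurable.const (N : ℂ)⁻¹).mul
    (isBddMeasurable_trace_mul_wignerResolvent (N := N) hz 1)
  simp only [one_mul] at h
  exact h

lemma norm_wignerStieltjes_le (hz : 0 < z.im) (x : WignerIndex N → ℝ) :
    ‖wignerStieltjes z x‖ ≤ (z.im)⁻¹ := by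
  rcases eq_or_ne N 0 with rfl | hN
  · simp [wignerStieltjes, hz.le]
  have hN' : (0 : ℝ) < N := by positivity
  rw [wignerStieltjes, norm_mul, norm_inv, Complex.norm_natCast, inv_mul_le_iff₀ hN']
  refine (Matrix.norm_trace_le _).trans ?_
  rw [Fintype.card_fin]
  gcongr
  exact norm_wignerResolvent_le hz x

/-- The normalised trace of (z - M/√N) G = 1, with M expanded in the basis so that each Gaussian
factor x_c is exposed for integration by parts. -/
lemma mul_wignerStieltjes (hN : N ≠ 0) (hz : 0 < z.im) (x : WignerIndex N → ℝ) :
    z * wignerStieltjes z x = 1 + (N : ℂ)⁻¹ * ((√(N : ℝ))⁻¹ : ℝ) *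
      ∑ c, (x c : ℂ) * (wignerBasis c * wignerResolvent z x).trace := by
  have h := congrArg Matrix.trace
    ((isHermitian_smul_wignerMatrix x (√(N : ℝ))⁻¹).sub_mul_resolvent hz)
  change ((z • 1 - _) * wignerResolvent z x).trace = _ at h
  rw [sub_mul, Matrix.trace_sub, smul_mul_assoc, one_mul, Matrix.trace_smul, Matrix.trace_one,
    smul_mul_assoc, Matrix.trace_smul, wignerMatrix, Finset.sum_mul, Matrix.trace_sum,
    Fintype.card_fin, smul_eq_mul, Complex.real_smul] at h
  simp only [smul_mul_assoc, Matrix.trace_smul, Complex.real_smul] at h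
  have hN' : (N : ℂ) ≠ 0 := by exact_mod_cast hN
  rw [wignerStieltjes, mul_left_comm, eq_add_of_sub_eq h, mul_add, mul_assoc]
  rw [inv_mul_cancel₀ hN', add_comm]

end WignerResolvent

/-! ### The loop equation and convergence of the mean Stieltjes transform. -/

section LoopEquation

open scoped Matrix.Norms.L2Operator

variable {N : ℕ} {z : ℂ}

/-- The defect of the self-consistent equation `m² - z m + 1 = 0`. -/
noncomputable def wignerDefect (z : ℂ) (x : WignerIndex N → ℝ) : ℂ :=
  z * wignerStieltjes z x - 1 - wignerStieltjes z x ^ 2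

lemma isBddMeasurable_wignerDefect (hz : 0 < z.im) :
    IsBddMeasurable (wignerDefect (N := N) z) := by
  have hm := wignerStieltjes_isBddMeasurable (N := N) hz
  have h := (((IsBddMeasurable.const z).mul hm).sub (.const 1)).sub (hm.mul hm)
  simp only [← sq] at h
  exact h

lemma conj_trace_wignerBasis_mul (c : WignerIndex N) (A : Matrix (Fin N) (Fin N) ℂ) :
    starRingEnd ℂ (wignerBasis c * A).trace = (wignerBasis c * A.conjTranspose).trace := by
  rw [← RCLike.star_def, ← Matrix.trace_conjTranspose, Matrix.conjTranspose_mul,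
    (wignerBasis_isHermitian c).eq, Matrix.trace_mul_comm]

lemma hasDerivAt_wignerStieltjes_update (hz : 0 < z.im) (x : WignerIndex N → ℝ)
    (c : WignerIndex N) :
    HasDerivAt (fun t => wignerStieltjes z (Function.update x c t))
      ((N : ℂ)⁻¹ * ((√(N : ℝ))⁻¹ : ℝ) * (wignerBasis c * wignerResolvent z x ^ 2).trace)
      (x c) := by
  have h := (hasDerivAt_trace_mul_wignerResolvent_update hz x c 1).const_mul (N : ℂ)⁻¹
  simp only [one_mul] at h
  refine h.congr_deriv ?_
  rw [mul_assoc (N : ℂ)⁻¹, Matrix.trace_mul_cycle, Matrix.trace_mul_comm, ← sq]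

lemma hasDerivAt_wignerDefect_update (hz : 0 < z.im) (x : WignerIndex N → ℝ)
    (c : WignerIndex N) :
    HasDerivAt (fun t => wignerDefect z (Function.update x c t))
      ((N : ℂ)⁻¹ * ((√(N : ℝ))⁻¹ : ℝ) * ((z - 2 * wignerStieltjes z x) *
        (wignerBasis c * wignerResolvent z x ^ 2).trace)) (x c) := by
  have h := hasDerivAt_wignerStieltjes_update hz x c
  refine (((h.const_mul z).sub_const 1).sub (h.pow 2)).congr_deriv ?_
  simp only [Function.update_eq_self]
  push_cast
  ring

lemma isBddMeasurable_trace_wignerResolvent_sq (hz : 0 < z.im)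
    (A B : Matrix (Fin N) (Fin N) ℂ) :
    IsBddMeasurable fun x => (A * wignerResolvent z x * B * wignerResolvent z x).trace := by
  have hc := continuous_wignerResolvent (N := N) hz
  refine ⟨(by fun_prop : Continuous _).measurable,
    N * (‖A‖ * (z.im)⁻¹ * ‖B‖ * (z.im)⁻¹), fun x => ?_⟩
  refine (Matrix.norm_trace_le _).trans ?_
  rw [Fintype.card_fin]
  have := norm_wignerResolvent_le hz x
  gcongr
  refine (norm_mul_le _ _).trans ?_
  gcongr
  refine (norm_mul_le _ _).trans ?_
  gcongr
  refine (norm_mul_le _ _).trans ?_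
  gcongr

/-- The derivative appearing in the Gaussian integration by parts. -/
noncomputable def loopDerivative (z : ℂ) (c : WignerIndex N) (x : WignerIndex N → ℝ) : ℂ :=
  ((√(N : ℝ))⁻¹ : ℝ) * (wignerBasis c * wignerResolvent z x * wignerBasis c *
      wignerResolvent z x).trace * starRingEnd ℂ (wignerDefect z x) +
    (wignerBasis c * wignerResolvent z x).trace * ((N : ℂ)⁻¹ * ((√(N : ℝ))⁻¹ : ℝ) *
      (starRingEnd ℂ (z - 2 * wignerStieltjes z x) *
        (wignerBasis c * (wignerResolvent z x ^ 2).conjTranspose).trace))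

lemma isBddMeasurable_loopDerivative (hz : 0 < z.im) (c : WignerIndex N) :
    IsBddMeasurable (loopDerivative z c) := by
  have hm := wignerStieltjes_isBddMeasurable (N := N) hz
  have h2 : IsBddMeasurable fun x =>
      (wignerBasis c * (wignerResolvent z x ^ 2).conjTranspose).trace := by
    have := (isBddMeasurable_trace_wignerResolvent_sq hz (wignerBasis c) 1).conj
    simp only [mul_one, mul_assoc _ (wignerResolvent z _) (wignerResolvent z _), ← sq,
      conj_trace_wignerBasis_mul] at this
    exact this
  exact (((IsBddMeasurable.const _).mul (isBddMeasurable_trace_wignerResolvent_sq hz _ _)).mul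
    (isBddMeasurable_wignerDefect hz).conj).add
    ((isBddMeasurable_trace_mul_wignerResolvent hz _).mul ((IsBddMeasurable.const _).mul
      (((IsBddMeasurable.const z).sub ((IsBddMeasurable.const 2).mul hm)).conj.mul h2)))

lemma integral_eval_mul_trace_mul_defect (hz : 0 < z.im) (c : WignerIndex N) :
    ∫ x, (x c : ℂ) * ((wignerBasis c * wignerResolvent z x).trace *
        starRingEnd ℂ (wignerDefect z x)) ∂(gaussianPi (WignerIndex N)) =
      ∫ x, loopDerivative z c x ∂(gaussianPi (WignerIndex N)) := by
  refine IsBddMeasurable.integral_eval_mul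
    ((isBddMeasurable_trace_mul_wignerResolvent hz _).mul (isBddMeasurable_wignerDefect hz).conj)
    (isBddMeasurable_loopDerivative hz c) c fun x => ?_
  have h1 := hasDerivAt_trace_mul_wignerResolvent_update hz x c (wignerBasis c)
  have h2 := (hasDerivAt_wignerDefect_update hz x c).star
  refine (h1.mul h2).congr_deriv ?_
  simp only [Function.update_eq_self, RCLike.star_def, map_mul, map_inv₀, Complex.conj_ofReal,
    conj_trace_wignerBasis_mul, map_natCast]
  rfl

/-- The product rule leaves two sums over the basis: the splitting contraction gives m² times the
conjugate defect, the merging one gives the remainder of order N⁻³ times a trace. -/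
lemma sum_loopDerivative (hN : N ≠ 0) (x : WignerIndex N → ℝ) :
    (N : ℂ)⁻¹ * ((√(N : ℝ))⁻¹ : ℝ) * ∑ c, loopDerivative z c x =
      wignerStieltjes z x ^ 2 * starRingEnd ℂ (wignerDefect z x) +
      ((N : ℂ)⁻¹) ^ 3 * (starRingEnd ℂ (z - 2 * wignerStieltjes z x) *
        (wignerResolvent z x * (wignerResolvent z x ^ 2).conjTranspose).trace) := by
  have hr : (((√(N : ℝ))⁻¹ : ℝ) : ℂ) * ((√(N : ℝ))⁻¹ : ℝ) = (N : ℂ)⁻¹ := by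
    rw [← Complex.ofReal_mul, ← mul_inv, Real.mul_self_sqrt (Nat.cast_nonneg N)]
    simp
  have hN' : (N : ℂ) ≠ 0 := by exact_mod_cast hN
  simp only [loopDerivative]
  rw [Finset.sum_add_distrib, ← Finset.sum_mul, ← Finset.mul_sum,
    sum_trace_wignerBasis_mul_mul_mul]
  have h2 : ∑ c, (wignerBasis c * wignerResolvent z x).trace *
      ((N : ℂ)⁻¹ * ((√(N : ℝ))⁻¹ : ℝ) * (starRingEnd ℂ (z - 2 * wignerStieltjes z x) *
        (wignerBasis c * (wignerResolvent z x ^ 2).conjTranspose).trace)) =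
      (N : ℂ)⁻¹ * ((√(N : ℝ))⁻¹ : ℝ) * (starRingEnd ℂ (z - 2 * wignerStieltjes z x) *
        (wignerResolvent z x * (wignerResolvent z x ^ 2).conjTranspose).trace) := by
    rw [← sum_trace_wignerBasis_mul_mul_trace, Finset.mul_sum, Finset.mul_sum]
    exact Finset.sum_congr rfl fun c _ => by ring
  rw [h2]
  have hm : wignerStieltjes z x ^ 2 = (N : ℂ)⁻¹ ^ 2 * (wignerResolvent z x).trace ^ 2 := by
    rw [wignerStieltjes, mul_pow]
  rw [hm]
  generalize (((√(N : ℝ))⁻¹ : ℝ) : ℂ) = r at hr ⊢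
  linear_combination ((N : ℂ)⁻¹ * (wignerResolvent z x).trace ^ 2 *
    starRingEnd ℂ (wignerDefect z x) + (N : ℂ)⁻¹ ^ 2 *
      (starRingEnd ℂ (z - 2 * wignerStieltjes z x) *
        (wignerResolvent z x * (wignerResolvent z x ^ 2).conjTranspose).trace)) * hr

/-- The loop equation, tested against the defect. -/
lemma integral_defect_mul_conj_defect (hN : N ≠ 0) (hz : 0 < z.im) :
    ∫ x, wignerDefect z x * starRingEnd ℂ (wignerDefect z x) ∂(gaussianPi (WignerIndex N)) =
      ∫ x, ((N : ℂ)⁻¹) ^ 3 * (starRingEnd ℂ (z - 2 * wignerStieltjes z x) *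
        (wignerResolvent z x * (wignerResolvent z x ^ 2).conjTranspose).trace)
          ∂(gaussianPi (WignerIndex N)) := by
  have hD := isBddMeasurable_wignerDefect (N := N) hz
  have hm := wignerStieltjes_isBddMeasurable (N := N) hz
  -- Only one factor D is expanded. The subtracted m² term is exactly the main term that integration
  -- by parts will produce.
  have e1 : ∀ x : WignerIndex N → ℝ,
      wignerDefect z x * starRingEnd ℂ (wignerDefect z x) =
        (N : ℂ)⁻¹ * ((√(N : ℝ))⁻¹ : ℝ) * ∑ c, (x c : ℂ) *
          ((wignerBasis c * wignerResolvent z x).trace * starRingEnd ℂ (wignerDefect z x)) -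
        wignerStieltjes z x ^ 2 * starRingEnd ℂ (wignerDefect z x) := by
    intro x
    have hd : wignerDefect z x = (N : ℂ)⁻¹ * ((√(N : ℝ))⁻¹ : ℝ) *
        ∑ c, (x c : ℂ) * (wignerBasis c * wignerResolvent z x).trace -
          wignerStieltjes z x ^ 2 := by
      rw [wignerDefect, mul_wignerStieltjes hN hz x]
      ring
    generalize starRingEnd ℂ (wignerDefect z x) = φ
    rw [hd]
    simp only [← mul_assoc, ← Finset.sum_mul]
    ring
  have i1 : ∀ c, Integrable (fun x : WignerIndex N → ℝ => (x c : ℂ) *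
      ((wignerBasis c * wignerResolvent z x).trace * starRingEnd ℂ (wignerDefect z x)))
      (gaussianPi (WignerIndex N)) := fun c =>
    ((isBddMeasurable_trace_mul_wignerResolvent hz _).mul hD.conj).integrable_eval_mul c
  have i2 : Integrable (fun x : WignerIndex N → ℝ =>
      wignerStieltjes z x ^ 2 * starRingEnd ℂ (wignerDefect z x))
      (gaussianPi (WignerIndex N)) := by
    have := ((hm.mul hm).mul hD.conj).integrable (μ := gaussianPi (WignerIndex N))
    simpa only [← sq] using this
  have i3 : ∀ c, Integrable (loopDerivative z c) (gaussianPi (WignerIndex N)) :=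
    fun c => (isBddMeasurable_loopDerivative hz c).integrable
  simp_rw [e1]
  rw [integral_sub ((integrable_finsetSum _ fun c _ => i1 c).const_mul _) i2,
    integral_const_mul, integral_finsetSum _ fun c _ => i1 c]
  simp_rw [integral_eval_mul_trace_mul_defect hz]
  rw [← integral_finsetSum _ fun c _ => i3 c, ← integral_const_mul,
    ← integral_sub ((integrable_finsetSum _ fun c _ => i3 c).const_mul _) i2]
  congr 1 with x
  rw [sum_loopDerivative hN]
  ring

/-- The prefactor N⁻³ meets a trace of size at most N (Im z)⁻³, which leaves N⁻². -/
lemma integral_norm_sq_wignerDefect_le (hN : N ≠ 0) (hz : 0 < z.im) :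
    ∫ x, ‖wignerDefect z x‖ ^ 2 ∂(gaussianPi (WignerIndex N)) ≤
      (‖z‖ + 2 * (z.im)⁻¹) * (z.im)⁻¹ ^ 3 * ((N : ℝ)⁻¹) ^ 2 := by
  have hN' : (N : ℝ) ≠ 0 := by exact_mod_cast hN
  have h := congrArg norm (integral_defect_mul_conj_defect hN hz)
  simp_rw [Complex.mul_conj, Complex.normSq_eq_norm_sq] at h
  rw [integral_complex_ofReal, Complex.norm_real, Real.norm_of_nonneg
    (integral_nonneg fun x => by positivity)] at h
  rw [h]
  have key : ∀ x : WignerIndex N → ℝ,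
      ‖((N : ℂ)⁻¹) ^ 3 * (starRingEnd ℂ (z - 2 * wignerStieltjes z x) *
        (wignerResolvent z x * (wignerResolvent z x ^ 2).conjTranspose).trace)‖ ≤
      (‖z‖ + 2 * (z.im)⁻¹) * (z.im)⁻¹ ^ 3 * ((N : ℝ)⁻¹) ^ 2 := by
    intro x
    have hG := norm_wignerResolvent_le hz x
    have h1 : ‖z - 2 * wignerStieltjes z x‖ ≤ ‖z‖ + 2 * (z.im)⁻¹ := by
      refine (norm_sub_le _ _).trans ?_
      rw [norm_mul, Complex.norm_ofNat]
      gcongr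
      exact norm_wignerStieltjes_le hz x
    have h2 : ‖(wignerResolvent z x * (wignerResolvent z x ^ 2).conjTranspose).trace‖ ≤
        N * (z.im)⁻¹ ^ 3 := by
      refine (Matrix.norm_trace_le _).trans ?_
      rw [Fintype.card_fin, pow_succ' _ 2]
      gcongr
      refine (norm_mul_le _ _).trans ?_
      gcongr
      rw [Matrix.l2_opNorm_conjTranspose, sq, sq]
      refine (norm_mul_le _ _).trans ?_
      gcongr
    rw [norm_mul, norm_mul, RCLike.norm_conj, norm_pow, norm_inv, Complex.norm_natCast]
    calc (N : ℝ)⁻¹ ^ 3 * (‖z - 2 * wignerStieltjes z x‖ *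
          ‖(wignerResolvent z x * (wignerResolvent z x ^ 2).conjTranspose).trace‖)
        ≤ (N : ℝ)⁻¹ ^ 3 * ((‖z‖ + 2 * (z.im)⁻¹) * (N * (z.im)⁻¹ ^ 3)) := by gcongr
      _ = _ := by field_simp
  simpa using norm_integral_le_of_norm_le_const (μ := gaussianPi (WignerIndex N)) (.of_forall key)

lemma im_wignerStieltjes_nonpos (hz : 0 < z.im) (x : WignerIndex N → ℝ) :
    (wignerStieltjes z x).im ≤ 0 := by
  have h := (isHermitian_smul_wignerMatrix x (√(N : ℝ))⁻¹).im_trace_resolvent_nonpos hz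
  have e : (N : ℂ)⁻¹ = (((N : ℝ)⁻¹ : ℝ) : ℂ) := by push_cast; rfl
  rw [wignerStieltjes, e, Complex.im_ofReal_mul]
  exact mul_nonpos_of_nonneg_of_nonpos (by positivity) h

/-- Stability of the self-consistent equation. -/
lemma norm_wignerStieltjes_sub_le (hz : 0 < z.im) {s : ℂ} (hs : s ^ 2 - z * s + 1 = 0)
    (hs' : s.im ≤ 0) (x : WignerIndex N → ℝ) :
    ‖wignerStieltjes z x - s‖ ≤ (z.im)⁻¹ * ‖wignerDefect z x‖ := by
  -- As s is a root, D factors through m - s. The other factor has imaginary part at least Im z,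
  -- because Im s and Im m are nonpositive.
  have h1 : wignerDefect z x = (wignerStieltjes z x - s) * (z - s - wignerStieltjes z x) := by
    rw [wignerDefect]
    linear_combination -hs
  have h2 : z.im ≤ ‖z - s - wignerStieltjes z x‖ := by
    refine le_trans ?_ (Complex.im_le_norm _)
    simp only [Complex.sub_im]
    linarith [im_wignerStieltjes_nonpos hz x]
  rw [h1, norm_mul, inv_mul_eq_div, le_div_iff₀ hz]
  gcongr

lemma tendsto_integral_wignerStieltjes (hz : 0 < z.im) {s : ℂ} (hs : s ^ 2 - z * s + 1 = 0)
    (hs' : s.im ≤ 0) :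
    Tendsto (fun N : ℕ => ∫ x, wignerStieltjes z x ∂(gaussianPi (WignerIndex N))) atTop
      (𝓝 s) := by
  rw [tendsto_iff_norm_sub_tendsto_zero]
  set K := (‖z‖ + 2 * (z.im)⁻¹) * (z.im)⁻¹ ^ 3
  have hlim : Tendsto (fun N : ℕ => (z.im)⁻¹ * (1 + K) * (N : ℝ)⁻¹) atTop (𝓝 0) := by
    simpa using (tendsto_inv_atTop_nhds_zero_nat (𝕜 := ℝ)).const_mul ((z.im)⁻¹ * (1 + K))
  refine squeeze_zero' (.of_forall fun _ => norm_nonneg _) ?_ hlim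
  filter_upwards [eventually_ne_atTop 0] with N hN
  have hN' : (0 : ℝ) < N := by positivity
  have hm := wignerStieltjes_isBddMeasurable (N := N) hz
  have hD := isBddMeasurable_wignerDefect (N := N) hz
  have iD2 : Integrable (fun x : WignerIndex N → ℝ => ‖wignerDefect z x‖ ^ 2)
      (gaussianPi (WignerIndex N)) := by
    have := (hD.mul hD).integrable (μ := gaussianPi (WignerIndex N)).norm
    simpa only [← sq, norm_pow] using this
  have e : ∫ x, wignerStieltjes z x ∂(gaussianPi (WignerIndex N)) - s =
      ∫ x, (wignerStieltjes z x - s) ∂(gaussianPi (WignerIndex N)) := by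
    rw [integral_sub hm.integrable (integrable_const _)]
    simp
  rw [e]
  calc ‖∫ x, (wignerStieltjes z x - s) ∂(gaussianPi (WignerIndex N))‖
      ≤ ∫ x, (z.im)⁻¹ * ((N : ℝ)⁻¹ + N * ‖wignerDefect z x‖ ^ 2)
          ∂(gaussianPi (WignerIndex N)) := by
        refine norm_integral_le_of_norm_le
          (((integrable_const _).add (iD2.const_mul _)).const_mul _) (.of_forall fun x => ?_)
        refine (norm_wignerStieltjes_sub_le hz hs hs' x).trans ?_
        gcongr
        -- The bound 2|D| ≤ N⁻¹ + N|D|² stands in for Cauchy–Schwarz; the weight N balances both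
        -- terms, since E|D|² is O(N⁻²).
        have h0 : 0 ≤ (N : ℝ)⁻¹ * (N * ‖wignerDefect z x‖ - 1) ^ 2 := by positivity
        have h1 : (N : ℝ)⁻¹ * (N * ‖wignerDefect z x‖ - 1) ^ 2 =
          N * ‖wignerDefect z x‖ ^ 2 - 2 * ‖wignerDefect z x‖ + (N : ℝ)⁻¹ := by
          field_simp
          ring
        linarith [norm_nonneg (wignerDefect z x)]
    _ = (z.im)⁻¹ * ((N : ℝ)⁻¹ + N * ∫ x, ‖wignerDefect z x‖ ^ 2
          ∂(gaussianPi (WignerIndex N))) := by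
        rw [integral_const_mul, integral_add (integrable_const _) (iD2.const_mul _),
          integral_const_mul]
        simp
    _ ≤ (z.im)⁻¹ * ((N : ℝ)⁻¹ + N * (K * (N : ℝ)⁻¹ ^ 2)) := by
        gcongr
        exact integral_norm_sq_wignerDefect_le hN hz
    _ = (z.im)⁻¹ * (1 + K) * (N : ℝ)⁻¹ := by
        field_simp

end LoopEquation

/-! ### The Stieltjes transform of the semicircle law. -/

section Semicircle

/-- The roots of w² - z w + 1 have product 1. If neither lay inside the unit disc, both would have
modulus 1 and be conjugate, making their sum z real. -/
lemma exists_norm_lt_one_add_inv {z : ℂ} (hz : 0 < z.im) :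
    ∃ w : ℂ, ‖w‖ < 1 ∧ w ≠ 0 ∧ w + w⁻¹ = z ∧ w.im ≤ 0 := by
  obtain ⟨d, hd⟩ := IsAlgClosed.exists_pow_nat_eq (z ^ 2 - 4) (n := 2) (by norm_num)
  have key : ∀ w : ℂ, ‖w‖ < 1 → w * (z - w) = 1 →
      ∃ w : ℂ, ‖w‖ < 1 ∧ w ≠ 0 ∧ w + w⁻¹ = z ∧ w.im ≤ 0 := by
    intro w hw1 hw
    have h0 : w ≠ 0 := by rintro rfl; simp at hw
    have hinv : w⁻¹ = z - w := inv_eq_of_mul_eq_one_right hw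
    refine ⟨w, hw1, h0, by rw [hinv]; ring, ?_⟩
    have h1 := congrArg Complex.im hinv
    rw [Complex.inv_im, Complex.sub_im] at h1
    have h2 : 0 < Complex.normSq w := Complex.normSq_pos.2 h0
    have h3 : Complex.normSq w < 1 := by
      rw [Complex.normSq_eq_norm_sq]
      exact pow_lt_one₀ (norm_nonneg _) hw1 two_ne_zero
    -- If Im w > 0 and |w| < 1, then Im(w + w⁻¹) = Im w (1 - |w|⁻²) is negative, contradicting Im z
    -- > 0.
    by_contra! h
    have h4 : w.im ≤ w.im / Complex.normSq w := by
      rw [le_div_iff₀ h2]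
      nlinarith
    rw [neg_div] at h1
    linarith
  have hprod : (z + d) / 2 * ((z - d) / 2) = 1 := by linear_combination -(1 / 4) * hd
  by_cases h1 : ‖(z + d) / 2‖ < 1
  · exact key _ h1 (by rw [← hprod]; ring)
  by_cases h2 : ‖(z - d) / 2‖ < 1
  · exact key _ h2 (by rw [← hprod]; ring)
  exfalso
  push Not at h1 h2
  have h3 := congrArg norm hprod
  rw [norm_mul, norm_one] at h3
  have h4 : ‖(z + d) / 2‖ = 1 := by nlinarith
  have h5 : (z - d) / 2 = starRingEnd ℂ ((z + d) / 2) := by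
    have h6 : (z + d) / 2 * starRingEnd ℂ ((z + d) / 2) = 1 := by
      rw [Complex.mul_conj, Complex.normSq_eq_norm_sq, h4]; simp
    have hne : (z + d) / 2 ≠ 0 := by intro h; rw [h] at h4; simp at h4
    exact mul_left_cancel₀ hne (hprod.trans h6.symm)
  have h7 : z = (z + d) / 2 + starRingEnd ℂ ((z + d) / 2) := by rw [← h5]; ring
  have h8 := congrArg Complex.im h7
  rw [Complex.add_im, Complex.conj_im] at h8
  linarith

lemma integral_sin_mul_sin_nat_mul {n : ℕ} (hn : 2 ≤ n) :
    ∫ θ in (0 : ℝ)..Real.pi, Real.sin θ * Real.sin (n * θ) = 0 := by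
  have hc : ∀ m : ℕ, m ≠ 0 → ∫ θ in (0 : ℝ)..Real.pi, Real.cos (m * θ) = 0 := by
    intro m hm
    rw [intervalIntegral.integral_comp_mul_left (fun x => Real.cos x) (by exact_mod_cast hm),
      integral_cos, Real.sin_nat_mul_pi]
    simp
  obtain ⟨k, rfl⟩ := Nat.exists_eq_add_of_le' hn
  have e : ∀ θ : ℝ, Real.sin θ * Real.sin ((k + 2 : ℕ) * θ) =
      2⁻¹ * (Real.cos ((k + 1 : ℕ) * θ) - Real.cos ((k + 3 : ℕ) * θ)) := by
    intro θ
    have h1 : ((k + 1 : ℕ) : ℝ) * θ = (k + 2 : ℕ) * θ - θ := by push_cast; ring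
    have h3 : ((k + 3 : ℕ) : ℝ) * θ = (k + 2 : ℕ) * θ + θ := by push_cast; ring
    rw [h1, h3, Real.cos_sub, Real.cos_add]
    ring
  simp_rw [e]
  rw [intervalIntegral.integral_const_mul, intervalIntegral.integral_sub, hc _ (by omega),
    hc _ (by omega)]
  · simp
  · exact (by fun_prop : Continuous _).intervalIntegrable _ _
  · exact (by fun_prop : Continuous _).intervalIntegrable _ _

lemma integral_sin_mul_sin :
    ∫ θ in (0 : ℝ)..Real.pi, Real.sin θ * Real.sin θ = Real.pi / 2 := by
  have := integral_sin_sq (a := 0) (b := Real.pi)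
  simp only [sq] at this
  rw [this]
  simp

/-- The integral `∫ sin² θ / (z - 2 cos θ)` over `[0, π]`. -/
lemma integral_sin_mul_sin_div {z w : ℂ} (hz : 0 < z.im) (hw : ‖w‖ < 1) (hw0 : w ≠ 0)
    (hzw : w + w⁻¹ = z) :
    ∫ θ in (0 : ℝ)..Real.pi, ((Real.sin θ * Real.sin θ : ℝ) : ℂ) *
      (z - (2 * Real.cos θ : ℝ))⁻¹ = w * (Real.pi / 2) := by
  have hne : ∀ θ : ℝ, z - (2 * Real.cos θ : ℝ) ≠ 0 := fun θ h => by
    have := congrArg Complex.im h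
    rw [Complex.sub_im, Complex.ofReal_im, Complex.zero_im] at this
    linarith
  -- The wanted integral is J 1. The identity sin((n+2)θ) + sin(nθ) = 2 cos θ sin((n+1)θ) yields a
  -- three-term recurrence with characteristic roots w and w⁻¹; by orthogonality of sines its source
  -- term is nonzero only at n = 0.
  set J : ℕ → ℂ := fun n => ∫ θ in (0 : ℝ)..Real.pi,
    ((Real.sin θ * Real.sin (n * θ) : ℝ) : ℂ) * (z - (2 * Real.cos θ : ℝ))⁻¹ with hJ
  have hcont : ∀ n : ℕ, Continuous fun θ : ℝ =>
      ((Real.sin θ * Real.sin (n * θ) : ℝ) : ℂ) * (z - (2 * Real.cos θ : ℝ))⁻¹ := by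
    intro n
    refine Continuous.mul (by fun_prop) (Continuous.inv₀ (by fun_prop) hne)
  have hrec : ∀ n : ℕ, J (n + 2) + J n = z * J (n + 1) -
      ((∫ θ in (0 : ℝ)..Real.pi, Real.sin θ * Real.sin ((n + 1 : ℕ) * θ) : ℝ) : ℂ) := by
    intro n
    simp only [hJ]
    rw [← intervalIntegral.integral_ofReal, ← intervalIntegral.integral_const_mul,
      ← intervalIntegral.integral_add ((hcont _).intervalIntegrable _ _)
        ((hcont _).intervalIntegrable _ _),
      ← intervalIntegral.integral_sub (((hcont _).const_mul _ |>.intervalIntegrable _ _))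
        ((by fun_prop : Continuous _).intervalIntegrable _ _)]
    congr 1 with θ
    have h1 : Real.sin ((n + 2 : ℕ) * θ) + Real.sin (n * θ) =
        2 * Real.cos θ * Real.sin ((n + 1 : ℕ) * θ) := by
      have h2 : ((n + 2 : ℕ) : ℝ) * θ = (n + 1 : ℕ) * θ + θ := by push_cast; ring
      have h3 : (n : ℝ) * θ = (n + 1 : ℕ) * θ - θ := by push_cast; ring
      rw [h2, h3, Real.sin_add, Real.sin_sub]
      ring
    have h4 := congrArg (Complex.ofReal) h1
    have h5 := mul_inv_cancel₀ (hne θ)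
    simp only [Complex.ofReal_mul, Complex.ofReal_add] at h4 h5 ⊢
    linear_combination (Real.sin θ : ℂ) * (z - ((2 : ℝ) : ℂ) * (Real.cos θ : ℂ))⁻¹ * h4 -
      (Real.sin θ : ℂ) * (Real.sin ((n + 1 : ℕ) * θ) : ℂ) * h5
  have hJ0 : J 0 = 0 := by simp [hJ]
  have hJ2 : J 2 = z * J 1 - Real.pi / 2 := by
    have := hrec 0
    simp only [zero_add, hJ0, add_zero, Nat.cast_one, one_mul, integral_sin_mul_sin] at this
    rw [this]; push_cast; rfl
  have hJr : ∀ n : ℕ, J (n + 3) = z * J (n + 2) - J (n + 1) := by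
    intro n
    have := hrec (n + 1)
    rw [integral_sin_mul_sin_nat_mul (by omega)] at this
    rw [eq_sub_iff_add_eq, this]
    simp
  have hbd : ∀ n, ‖J n‖ ≤ (z.im)⁻¹ * Real.pi := by
    intro n
    have := intervalIntegral.norm_integral_le_of_norm_le_const (a := 0) (b := Real.pi)
      (C := (z.im)⁻¹) (f := fun θ : ℝ =>
      ((Real.sin θ * Real.sin (n * θ) : ℝ) : ℂ) * (z - (2 * Real.cos θ : ℝ))⁻¹) ?_
    · rwa [sub_zero, abs_of_pos Real.pi_pos] at this
    · intro θ _
      have h1 : z.im ≤ ‖z - (2 * Real.cos θ : ℝ)‖ := by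
        refine le_trans ?_ (Complex.im_le_norm _)
        rw [Complex.sub_im, Complex.ofReal_im, sub_zero]
      rw [norm_mul, norm_inv, Complex.norm_real, norm_mul]
      calc ‖Real.sin θ‖ * ‖Real.sin (n * θ)‖ * ‖z - (2 * Real.cos θ : ℝ)‖⁻¹
          ≤ 1 * 1 * (z.im)⁻¹ := by
            gcongr
            · exact Real.abs_sin_le_one _
            · exact Real.abs_sin_le_one _
        _ = (z.im)⁻¹ := by ring
  -- This isolates the mode growing like w⁻ⁿ, which must vanish because J is bounded.
  have hD : ∀ n : ℕ, J 2 - w * J 1 = w ^ n * (J (n + 2) - w * J (n + 1)) := by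
    intro n
    induction n with
    | zero => simp
    | succ k ih =>
      rw [ih, hJr k, ← hzw]
      field_simp
      ring
  have hlim : Tendsto (fun n : ℕ => ‖w‖ ^ n * (2 * ((z.im)⁻¹ * Real.pi))) atTop (𝓝 0) := by
    simpa using (tendsto_pow_atTop_nhds_zero_of_lt_one (norm_nonneg w) hw).mul_const
      (2 * ((z.im)⁻¹ * Real.pi))
  have hD0 : J 2 - w * J 1 = 0 := by
    rw [← norm_le_zero_iff]
    refine ge_of_tendsto' hlim fun n => ?_
    rw [hD n, norm_mul, norm_pow]
    gcongr
    refine (norm_sub_le _ _).trans ?_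
    rw [norm_mul]
    have h1 := hbd (n + 2)
    have h2 := hbd (n + 1)
    have := norm_nonneg (J (n + 1))
    nlinarith
  have h1 : w⁻¹ * J 1 = Real.pi / 2 := by
    rw [hJ2, ← hzw] at hD0
    linear_combination hD0
  have h2 : J 1 = w * (Real.pi / 2) := by
    rw [← h1]; field_simp
  rw [← h2]
  simp [hJ]

lemma measurable_semicircleDensity : Measurable fun x : ℝ =>
    (Set.Icc (-2 : ℝ) 2).indicator (fun y => √(4 - y ^ 2) / (2 * Real.pi)) x :=
  (by fun_prop : Measurable fun y : ℝ => √(4 - y ^ 2) / (2 * Real.pi)).indicator measurableSet_Icc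

/-- The substitution x = 2 cos θ removes the square root and turns the law into (2/π) sin² θ dθ. -/
lemma integral_semicircleMeasure {g : ℝ → ℂ} (hg : Continuous g) :
    ∫ x, g x ∂semicircleMeasure = (2 / Real.pi : ℝ) *
      ∫ θ in (0 : ℝ)..Real.pi, ((Real.sin θ * Real.sin θ : ℝ) : ℂ) * g (2 * Real.cos θ) := by
  rw [semicircleMeasure, integral_withDensity_eq_integral_toReal_smul
    measurable_semicircleDensity.ennreal_ofReal (by simp)]
  have e1 : ∀ x : ℝ, (ENNReal.ofReal ((Set.Icc (-2 : ℝ) 2).indicator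
      (fun y => √(4 - y ^ 2) / (2 * Real.pi)) x)).toReal • g x =
      (Set.Icc (-2 : ℝ) 2).indicator
        (fun y => ((√(4 - y ^ 2) / (2 * Real.pi) : ℝ) : ℂ) * g y) x := by
    intro x
    rw [ENNReal.toReal_ofReal (Set.indicator_nonneg (fun y _ => by positivity) x)]
    by_cases hx : x ∈ Set.Icc (-2 : ℝ) 2 <;> simp [hx]
  simp_rw [e1]
  rw [integral_indicator measurableSet_Icc, integral_Icc_eq_integral_Ioc,
    ← intervalIntegral.integral_of_le (by norm_num)]
  have hsub := intervalIntegral.integral_deriv_smul_comp (a := 0) (b := Real.pi)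
    (f := fun θ : ℝ => 2 * Real.cos θ) (f' := fun θ => 2 * -Real.sin θ)
    (g := fun y => ((√(4 - y ^ 2) / (2 * Real.pi) : ℝ) : ℂ) * g y)
    (fun θ _ => (Real.hasDerivAt_cos θ).const_mul 2) (by fun_prop) (by fun_prop)
  simp only [Real.cos_zero, Real.cos_pi, mul_one, mul_neg] at hsub
  rw [intervalIntegral.integral_symm, ← hsub, ← intervalIntegral.integral_neg,
    ← intervalIntegral.integral_const_mul]
  refine intervalIntegral.integral_congr fun θ hθ => ?_
  rw [Set.uIcc_of_le Real.pi_pos.le] at hθ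
  have h1 : √(4 - (2 * Real.cos θ) ^ 2) = 2 * Real.sin θ := by
    rw [show 4 - (2 * Real.cos θ) ^ 2 = (2 * Real.sin θ) ^ 2 by
      nlinarith [Real.sin_sq_add_cos_sq θ]]
    exact Real.sqrt_sq (by have := Real.sin_nonneg_of_nonneg_of_le_pi hθ.1 hθ.2; positivity)
  simp only [Function.comp, h1, Complex.real_smul]
  have hpi : (Real.pi : ℂ) ≠ 0 := by exact_mod_cast Real.pi_ne_zero
  push_cast
  field_simp

instance isProbabilityMeasure_semicircleMeasure : IsProbabilityMeasure semicircleMeasure := by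
  have h := integral_semicircleMeasure (g := fun _ => 1) continuous_const
  have hpi : (Real.pi : ℂ) ≠ 0 := by exact_mod_cast Real.pi_ne_zero
  simp only [mul_one, intervalIntegral.integral_ofReal, integral_sin_mul_sin] at h
  have h1 : semicircleMeasure.real Set.univ = 1 := by
    have h2 : ((semicircleMeasure.real Set.univ : ℝ) : ℂ) = 1 := by
      simpa [hpi] using h
    exact_mod_cast h2
  refine ⟨?_⟩
  rw [Measure.real, ENNReal.toReal_eq_one_iff] at h1
  exact h1

lemma integral_inv_sub_semicircleMeasure {z w : ℂ} (hz : 0 < z.im) (hw : ‖w‖ < 1) (hw0 : w ≠ 0)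
    (hzw : w + w⁻¹ = z) : ∫ x : ℝ, (z - x)⁻¹ ∂semicircleMeasure = w := by
  have hne : ∀ x : ℝ, z - x ≠ 0 := fun x h => by
    have := congrArg Complex.im h
    rw [Complex.sub_im, Complex.ofReal_im, Complex.zero_im] at this
    linarith
  rw [integral_semicircleMeasure (g := fun x : ℝ => (z - x)⁻¹)
    (Continuous.inv₀ (by fun_prop) hne),
    integral_sin_mul_sin_div hz hw hw0 hzw]
  have hpi : (Real.pi : ℂ) ≠ 0 := by exact_mod_cast Real.pi_ne_zero
  push_cast
  field_simp

end Semicircle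

/-! ### From Stieltjes transforms to weak convergence, by Cauchy smoothing. -/

section StieltjesConvergence

/-- **Scheffé's lemma** for sequences of probability densities converging pointwise. -/
lemma tendsto_integral_abs_sub_of_tendsto {α : Type*} [MeasurableSpace α] {μ : Measure α}
    {p : ℕ → α → ℝ} {q : α → ℝ} {m : ℝ} (hp : ∀ n, Integrable (p n) μ) (hq : Integrable q μ)
    (hp0 : ∀ n x, 0 ≤ p n x) (hpm : ∀ n, ∫ x, p n x ∂μ = m) (hqm : ∫ x, q x ∂μ = m)
    (h : ∀ x, Tendsto (fun n => p n x) atTop (𝓝 (q x))) :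
    Tendsto (fun n => ∫ x, |p n x - q x| ∂μ) atTop (𝓝 0) := by
  have hq0 : ∀ x, 0 ≤ q x := fun x => ge_of_tendsto' (h x) fun n => hp0 n x
  have h1 : ∀ n, ∫ x, |p n x - q x| ∂μ = 2 * ∫ x, max (q x - p n x) 0 ∂μ := by
    intro n
    -- The first term integrates to zero by equality of masses; the positive part is dominated by
    -- `q`, so dominated convergence applies.
    have e : ∀ x, |p n x - q x| = (p n x - q x) + 2 * max (q x - p n x) 0 := by
      intro x
      rcases le_total (p n x) (q x) with h | h
      · rw [abs_of_nonpos (by linarith), max_eq_left (by linarith)]; ring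
      · rw [abs_of_nonneg (by linarith), max_eq_right (by linarith)]; ring
    have i1 : Integrable (fun x => p n x - q x) μ := (hp n).sub hq
    have i2 : Integrable (fun x => max (q x - p n x) 0) μ := (hq.sub (hp n)).pos_part
    simp_rw [e]
    rw [integral_add i1 (i2.const_mul 2), integral_sub (hp n) hq, hpm, hqm, integral_const_mul]
    ring
  simp_rw [h1]
  have h2 : Tendsto (fun n => ∫ x, max (q x - p n x) 0 ∂μ) atTop (𝓝 (∫ _, (0 : ℝ) ∂μ)) := by
    refine tendsto_integral_of_dominated_convergence q
      (fun n => (hq.sub (hp n)).pos_part.aestronglyMeasurable) hq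
      (fun n => .of_forall fun x => ?_) (.of_forall fun x => ?_)
    · rw [Real.norm_of_nonneg (le_max_right _ _)]
      exact max_le (by linarith [hp0 n x]) (hq0 x)
    · have := ((tendsto_const_nhds (x := q x)).sub (h x)).max (tendsto_const_nhds (x := (0 : ℝ)))
      simpa using this
  simpa using h2.const_mul 2

/-- The Cauchy (Poisson kernel) smoothing of a measure. -/
noncomputable def cauchySmoothing (μ : Measure ℝ) (η : ℝ≥0) (x : ℝ) : ℝ :=
  ∫ t, cauchyPDFReal t η x ∂μ

variable {μ : Measure ℝ} {η : ℝ≥0}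

lemma cauchySmoothing_nonneg (hη : η ≠ 0) (x : ℝ) : 0 ≤ cauchySmoothing μ η x :=
  integral_nonneg fun t => (cauchyPDF_pos t hη x).le

lemma measurable_uncurry_cauchyPDFReal :
    Measurable (fun p : ℝ × ℝ => cauchyPDFReal p.2 η p.1) := by
  unfold cauchyPDFReal
  fun_prop

variable [IsProbabilityMeasure μ]

lemma integrable_prod_cauchyPDFReal (hη : η ≠ 0) :
    Integrable (fun p : ℝ × ℝ => cauchyPDFReal p.2 η p.1) (volume.prod μ) := by
  rw [integrable_prod_iff' measurable_uncurry_cauchyPDFReal.aestronglyMeasurable]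
  refine ⟨.of_forall fun t => integrable_cauchyPDFReal t, ?_⟩
  simp_rw [Real.norm_of_nonneg (cauchyPDF_pos _ hη _).le, integral_cauchyPDFReal_eq_one _ hη]
  exact integrable_const _

lemma integrable_prod_mul_cauchyPDFReal (hη : η ≠ 0) {f : ℝ → ℝ} {B : ℝ} (hf : Measurable f)
    (hB : ∀ x, |f x| ≤ B) :
    Integrable (fun p : ℝ × ℝ => f p.1 * cauchyPDFReal p.2 η p.1) (volume.prod μ) :=
  (integrable_prod_cauchyPDFReal hη).bdd_mul (hf.comp measurable_fst).aestronglyMeasurable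
    (.of_forall fun p => hB p.1)

lemma integrable_cauchySmoothing (hη : η ≠ 0) : Integrable (cauchySmoothing μ η) :=
  (integrable_prod_cauchyPDFReal hη).integral_prod_left

lemma integral_mul_cauchySmoothing (hη : η ≠ 0) {f : ℝ → ℝ} {B : ℝ} (hf : Measurable f)
    (hB : ∀ x, |f x| ≤ B) :
    ∫ x, f x * cauchySmoothing μ η x = ∫ t, (∫ x, f x * cauchyPDFReal t η x) ∂μ := by
  simp_rw [cauchySmoothing, ← integral_const_mul]
  exact integral_integral_swap (f := fun x t => f x * cauchyPDFReal t η x)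
    (integrable_prod_mul_cauchyPDFReal hη hf hB)

lemma integral_cauchySmoothing (hη : η ≠ 0) : ∫ x, cauchySmoothing μ η x = 1 := by
  have h := integral_mul_cauchySmoothing (μ := μ) hη (f := fun _ => 1) (B := 1) measurable_const
    (by simp)
  simpa [integral_cauchyPDFReal_eq_one _ hη] using h

/-- The rescaling x = t + η u refers every kernel to the standard Cauchy law, which makes the
smoothing error uniform in `t`. -/
lemma integral_mul_cauchyPDFReal_eq (hη : η ≠ 0) (f : ℝ → ℝ) (t : ℝ) :
    ∫ x, f x * cauchyPDFReal t η x = ∫ u, f (t + η * u) * cauchyPDFReal 0 1 u := by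
  have hη' : (0 : ℝ) < η := by positivity
  have h1 := integral_add_left_eq_self (μ := volume) (fun x => f x * cauchyPDFReal t η x) t
  have h2 := Measure.integral_comp_mul_left (fun x => f (t + x) * cauchyPDFReal t η (t + x))
    (η : ℝ)
  rw [← h1, eq_comm, ← smul_right_injective ℝ (inv_pos.2 hη').ne' |>.eq_iff,
    ← abs_of_pos (inv_pos.2 hη'), ← h2, abs_of_pos (inv_pos.2 hη'), smul_eq_mul,
    ← integral_const_mul]
  congr 1 with u
  simp only [cauchyPDFReal_def]
  push_cast
  field_simp
  ring_nf

lemma integrable_mul_cauchyPDFReal {f : ℝ → ℝ} {B : ℝ} (hf : Measurable f)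
    (hB : ∀ x, |f x| ≤ B) (t : ℝ) (η : ℝ≥0) : Integrable fun x => f x * cauchyPDFReal t η x :=
  (integrable_cauchyPDFReal t).bdd_mul hf.aestronglyMeasurable (.of_forall hB)

/-- The modulus bounding the effect of smoothing on an `L`-Lipschitz function of oscillation at
most `C`. -/
noncomputable def smoothingError (L C : ℝ) (η : ℝ≥0) : ℝ :=
  ∫ u, min (L * (η * |u|)) C * cauchyPDFReal 0 1 u

lemma abs_min_le {a C : ℝ} (ha : 0 ≤ a) (hC : 0 ≤ C) : |min a C| ≤ C := by
  rw [abs_of_nonneg (le_min ha hC)]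
  exact min_le_right _ _

lemma abs_integral_mul_cauchyPDFReal_sub_le (hη : η ≠ 0) {f : ℝ → ℝ} {L : ℝ≥0} {C : ℝ}
    (hL : LipschitzWith L f) (hC : ∀ x y, dist (f x) (f y) ≤ C) (t : ℝ) :
    |(∫ x, f x * cauchyPDFReal t η x) - f t| ≤ smoothingError L C η := by
  have hC0 : 0 ≤ C := dist_nonneg.trans (hC 0 0)
  have hB : ∀ x, |f x| ≤ |f 0| + C := fun x => by
    have h1 := hC x 0
    rw [Real.dist_eq] at h1
    have h2 := abs_sub_abs_le_abs_sub (f x) (f 0)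
    linarith
  have hfm : Measurable f := hL.continuous.measurable
  have e : (∫ x, f x * cauchyPDFReal t η x) - f t =
      ∫ u, (f (t + η * u) - f t) * cauchyPDFReal 0 1 u := by
    simp_rw [sub_mul]
    rw [integral_sub (integrable_mul_cauchyPDFReal (f := fun u => f (t + η * u))
        (by fun_prop) (fun u => hB _) 0 1) ((integrable_cauchyPDFReal 0).const_mul _),
      integral_const_mul, integral_cauchyPDFReal_eq_one _ one_ne_zero,
      integral_mul_cauchyPDFReal_eq hη, mul_one]
  rw [e, ← Real.norm_eq_abs]
  refine norm_integral_le_of_norm_le (integrable_mul_cauchyPDFReal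
    (f := fun u => min (L * (η * |u|)) C) (by fun_prop)
    (fun u => abs_min_le (by positivity) hC0) 0 1) (.of_forall fun u => ?_)
  rw [norm_mul, Real.norm_of_nonneg (cauchyPDF_pos 0 one_ne_zero u).le]
  refine mul_le_mul_of_nonneg_right (le_min ?_ ?_) (cauchyPDF_pos 0 one_ne_zero u).le
  · rw [← dist_eq_norm]
    refine (hL.dist_le_mul _ _).trans_eq ?_
    simp
  · simpa [Real.dist_eq] using hC (t + η * u) t

lemma tendsto_smoothingError {L C : ℝ} (hL : 0 ≤ L) (hC : 0 ≤ C) {η : ℕ → ℝ≥0}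
    (hη : Tendsto η atTop (𝓝 0)) :
    Tendsto (fun k => smoothingError L C (η k)) atTop (𝓝 0) := by
  have h : Tendsto (fun k => smoothingError L C (η k)) atTop (𝓝 (∫ _ : ℝ, (0 : ℝ))) := by
    -- The Cauchy law has no first moment, so the Lipschitz bound alone is not integrable; the cap
    -- by `C` provides the dominating function.
    refine tendsto_integral_of_dominated_convergence (fun u => C * cauchyPDFReal 0 1 u)
      (fun k => (integrable_mul_cauchyPDFReal (f := fun u => min (L * (η k * |u|)) C)
        (by fun_prop) (fun u => abs_min_le (by positivity) hC) 0 1).aestronglyMeasurable)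
      ((integrable_cauchyPDFReal 0).const_mul C) (fun k => .of_forall fun u => ?_)
      (.of_forall fun u => ?_)
    · rw [norm_mul, Real.norm_of_nonneg (cauchyPDF_pos 0 one_ne_zero u).le]
      exact mul_le_mul_of_nonneg_right (abs_min_le (by positivity) hC)
        (cauchyPDF_pos 0 one_ne_zero u).le
    · have h1 : Tendsto (fun k => (η k : ℝ)) atTop (𝓝 0) := by
        exact_mod_cast (NNReal.continuous_coe.tendsto 0).comp hη
      have h2 := (((h1.mul_const |u|).const_mul L).min
        (tendsto_const_nhds (x := C))).mul_const (cauchyPDFReal 0 1 u)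
      simpa [hC] using h2
  simpa using h

lemma abs_integral_mul_cauchySmoothing_sub_le (hη : η ≠ 0) {f : ℝ → ℝ} {L : ℝ≥0} {C : ℝ}
    (hL : LipschitzWith L f) (hC : ∀ x y, dist (f x) (f y) ≤ C) :
    |(∫ x, f x * cauchySmoothing μ η x) - ∫ t, f t ∂μ| ≤ smoothingError L C η := by
  have hB : ∀ x, |f x| ≤ |f 0| + C := fun x => by
    have h1 := hC x 0
    rw [Real.dist_eq] at h1
    have h2 := abs_sub_abs_le_abs_sub (f x) (f 0)
    linarith
  have hfm : Measurable f := hL.continuous.measurable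
  rw [integral_mul_cauchySmoothing hη hfm hB, ← integral_sub
    (integrable_prod_mul_cauchyPDFReal hη hfm hB).integral_prod_right
    (.of_bound hfm.aestronglyMeasurable _ (.of_forall hB))]
  simpa using norm_integral_le_of_norm_le_const (μ := μ)
    (f := fun t => (∫ x, f x * cauchyPDFReal t η x) - f t) (C := smoothingError L C η)
    (.of_forall fun t => abs_integral_mul_cauchyPDFReal_sub_le hη hL hC t)

/-- The Poisson kernel is -π⁻¹ Im (x + iη - t)⁻¹, so the smoothed density is read off the Stieltjes
transform on the line Im z = η. -/
lemma cauchySmoothing_eq (hη : η ≠ 0) (x : ℝ) :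
    cauchySmoothing μ η x = -Real.pi⁻¹ * (∫ t : ℝ, ((⟨x, η⟩ : ℂ) - t)⁻¹ ∂μ).im := by
  have hη' : (0 : ℝ) < η := by positivity
  have hint : Integrable (fun t : ℝ => ((⟨x, η⟩ : ℂ) - t)⁻¹) μ := by
    refine .of_bound (by fun_prop) (η : ℝ)⁻¹ (.of_forall fun t => ?_)
    rw [norm_inv]
    gcongr
    refine le_trans ?_ (Complex.im_le_norm _)
    simp
  have him : (∫ t : ℝ, ((⟨x, η⟩ : ℂ) - t)⁻¹ ∂μ).im = ∫ t : ℝ, (((⟨x, η⟩ : ℂ) - t)⁻¹).im ∂μ :=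
    (integral_im hint).symm
  rw [him, cauchySmoothing, ← integral_const_mul]
  congr 1 with t
  rw [cauchyPDFReal_def, Complex.inv_im, Complex.normSq_apply]
  simp
  field_simp

/-- Convergence of Stieltjes transforms on the upper half-plane implies weak convergence. -/
theorem tendsto_of_tendsto_integral_inv_sub {ν : ℕ → ProbabilityMeasure ℝ}
    {σ : ProbabilityMeasure ℝ}
    (h : ∀ z : ℂ, 0 < z.im → Tendsto (fun n => ∫ t : ℝ, (z - t)⁻¹ ∂(ν n : Measure ℝ)) atTop
      (𝓝 (∫ t : ℝ, (z - t)⁻¹ ∂(σ : Measure ℝ)))) :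
    Tendsto ν atTop (𝓝 σ) := by
  rw [tendsto_iff_forall_lipschitz_integral_tendsto]
  rintro f ⟨C, hC⟩ ⟨L, hL⟩
  have hC0 : 0 ≤ C := dist_nonneg.trans (hC 0 0)
  have hB : ∀ x, |f x| ≤ |f 0| + C := fun x => by
    have h1 := hC x 0
    rw [Real.dist_eq] at h1
    have h2 := abs_sub_abs_le_abs_sub (f x) (f 0)
    linarith
  set B := |f 0| + C
  have hB0 : 0 ≤ B := by positivity
  have hfm : Measurable f := hL.continuous.measurable
  rw [Metric.tendsto_atTop]
  intro ε hε
  -- The scale η is fixed before n, uniformly over all measures. Two smoothing errors and one L¹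
  -- distance, each below ε/4, make up the total.
  obtain ⟨η, hη, hηε⟩ : ∃ η : ℝ≥0, η ≠ 0 ∧ smoothingError L C η < ε / 4 := by
    have hlim : Tendsto (fun k : ℕ => ((k : ℝ≥0) + 1)⁻¹) atTop (𝓝 0) := by
      have := tendsto_one_div_add_atTop_nhds_zero_nat (𝕜 := ℝ≥0)
      simpa using this
    obtain ⟨k, hk⟩ := ((tendsto_smoothingError L.2 hC0 hlim).eventually_lt_const
      (show (0 : ℝ) < ε / 4 by positivity)).exists
    exact ⟨_, by positivity, hk⟩
  have hη' : (0 : ℝ) < η := by positivity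
  -- At fixed η the smoothed densities have mass 1 and converge pointwise by hypothesis; Scheffé
  -- upgrades this to L¹.
  have hS := tendsto_integral_abs_sub_of_tendsto (μ := volume)
    (p := fun n => cauchySmoothing (ν n : Measure ℝ) η) (q := cauchySmoothing (σ : Measure ℝ) η)
    (fun n => integrable_cauchySmoothing hη) (integrable_cauchySmoothing hη)
    (fun n => cauchySmoothing_nonneg hη) (fun n => integral_cauchySmoothing hη)
    (integral_cauchySmoothing hη) (fun x => by
      simp_rw [cauchySmoothing_eq hη]
      exact ((Complex.continuous_im.tendsto _).comp (h ⟨x, η⟩ hη')).const_mul _)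
  have hS' := hS.const_mul B
  rw [mul_zero] at hS'
  obtain ⟨n₀, hn₀⟩ := eventually_atTop.1
    (hS'.eventually_lt_const (show (0 : ℝ) < ε / 4 by positivity))
  refine ⟨n₀, fun n hn => ?_⟩
  have h1 := abs_integral_mul_cauchySmoothing_sub_le (μ := (ν n : Measure ℝ)) hη hL hC
  have h2 := abs_integral_mul_cauchySmoothing_sub_le (μ := (σ : Measure ℝ)) hη hL hC
  have hi : ∀ ρ : ProbabilityMeasure ℝ,
      Integrable fun x => f x * cauchySmoothing (ρ : Measure ℝ) η x := fun ρ =>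
    (integrable_cauchySmoothing hη).bdd_mul hfm.aestronglyMeasurable (.of_forall hB)
  have h3 : |(∫ x, f x * cauchySmoothing (ν n : Measure ℝ) η x) -
      ∫ x, f x * cauchySmoothing (σ : Measure ℝ) η x| ≤
      B * ∫ x, |cauchySmoothing (ν n : Measure ℝ) η x - cauchySmoothing (σ : Measure ℝ) η x| := by
    rw [← integral_sub (hi _) (hi _), ← integral_const_mul, ← Real.norm_eq_abs]
    refine norm_integral_le_of_norm_le (((integrable_cauchySmoothing hη).sub
      (integrable_cauchySmoothing hη)).abs.const_mul B) (.of_forall fun x => ?_)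
    rw [← mul_sub, norm_mul]
    exact mul_le_mul_of_nonneg_right (hB x) (norm_nonneg _)
  have h4 := hn₀ n hn
  rw [Real.dist_eq]
  rw [abs_le] at h1 h2 h3
  rw [abs_lt]
  constructor <;> linarith [h1.1, h1.2, h2.1, h2.2, h3.1, h3.2]

end StieltjesConvergence

/-! ### The mean empirical spectral measure. -/

section EmpiricalMeasure

variable {N : ℕ}

/-- The Hermitian matrix with given coordinates, as an element of `HermitianMatrix`. -/
noncomputable def wignerHermitian (x : WignerIndex N → ℝ) : HermitianMatrix N :=
  ⟨wignerMatrix x, wignerMatrix_isHermitian x⟩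

lemma wignerHermitian_wignerCoord (A : HermitianMatrix N) : wignerHermitian (wignerCoord A) = A :=
  Subtype.ext (wignerMatrix_wignerCoord A)

lemma isProbabilityMeasure_empiricalSpectralMeasure [NeZero N] (A : HermitianMatrix N) :
    IsProbabilityMeasure (empiricalSpectralMeasure A) := by
  refine ⟨?_⟩
  simp only [empiricalSpectralMeasure, Measure.smul_apply, Measure.coe_finsetSum,
    Finset.sum_apply, measure_univ, Finset.sum_const, Finset.card_univ, Fintype.card_fin,
    nsmul_eq_mul, mul_one, smul_eq_mul]
  exact ENNReal.inv_mul_cancel (by exact_mod_cast NeZero.ne N) (by simp)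

lemma integral_empiricalSpectralMeasure {E : Type*} [NormedAddCommGroup E] [NormedSpace ℝ E]
    [CompleteSpace E] (A : HermitianMatrix N) (g : ℝ → E) :
    ∫ t, g t ∂(empiricalSpectralMeasure A) =
      (N : ℝ)⁻¹ • ∑ k, g (A.2.eigenvalues k / √(N : ℝ)) := by
  rw [empiricalSpectralMeasure, integral_smul_measure, integral_finsetSum_measure]
  · simp [ENNReal.toReal_inv]
  · intro k _
    exact integrable_dirac (by simp)

open scoped Matrix.Norms.L2Operator in
-- The sum is the trace of the functional calculus of `g`, which depends continuously on the matrix;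
-- continuity of individual eigenvalues is not needed.
lemma continuous_sum_eigenvalues {g : ℝ → ℝ} (hg : Continuous g) :
    Continuous fun x : WignerIndex N → ℝ => ∑ k, g ((wignerHermitian x).2.eigenvalues k) := by
  have h1 : Continuous fun x : WignerIndex N → ℝ => cfc g (wignerMatrix x) :=
    Continuous.cfc_of_mem_nhdsSet (s := Set.univ) g Filter.univ_mem continuous_wignerMatrix
      (fun x => (wignerMatrix_isHermitian x).isSelfAdjoint) hg.continuousOn
  have h2 : ∀ x : WignerIndex N → ℝ, ∑ k, g ((wignerHermitian x).2.eigenvalues k) =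
      (cfc g (wignerMatrix x)).trace.re := by
    intro x
    rw [(wignerMatrix_isHermitian x).cfc_eq g, Matrix.IsHermitian.cfc,
      Unitary.conjStarAlgAut_apply, Matrix.trace_mul_cycle]
    simp [Matrix.trace_diagonal, wignerHermitian]
  simp_rw [h2]
  fun_prop

lemma continuous_integral_empiricalSpectralMeasure {g : ℝ → ℝ} (hg : Continuous g) :
    Continuous fun x : WignerIndex N → ℝ =>
      ∫ t, g t ∂(empiricalSpectralMeasure (wignerHermitian x)) := by
  simp_rw [integral_empiricalSpectralMeasure]
  exact (continuous_sum_eigenvalues (g := fun t => g (t / √(N : ℝ))) (by fun_prop)).const_smul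
    (N : ℝ)⁻¹

/-- Closed sets form a generating π-system, and their indicators are limits of bounded continuous
functions, whose integrals are continuous in the coordinates. -/
lemma measurable_empiricalSpectralMeasure [NeZero N] :
    Measurable fun x : WignerIndex N → ℝ => empiricalSpectralMeasure (wignerHermitian x) := by
  have := fun x : WignerIndex N → ℝ =>
    isProbabilityMeasure_empiricalSpectralMeasure (wignerHermitian x)
  refine Measurable.measure_of_isPiSystem_of_isProbabilityMeasure
    (S := {s : Set ℝ | IsClosed s}) ?_ isPiSystem_isClosed fun s hs => ?_
  · rw [BorelSpace.measurable_eq (α := ℝ), borel_eq_generateFrom_isClosed]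
  · refine measurable_of_tendsto_metrizable (f := fun n x =>
      ∫⁻ t, hs.apprSeq n t ∂(empiricalSpectralMeasure (wignerHermitian x))) (fun n => ?_)
      (tendsto_pi_nhds.2 fun x => HasOuterApproxClosed.tendsto_lintegral_apprSeq hs _)
    have e : ∀ x : WignerIndex N → ℝ,
        ∫⁻ t, hs.apprSeq n t ∂(empiricalSpectralMeasure (wignerHermitian x)) =
        ENNReal.ofReal (∫ t, (hs.apprSeq n t : ℝ)
          ∂(empiricalSpectralMeasure (wignerHermitian x))) := by
      intro x
      rw [← BoundedContinuousFunction.toReal_lintegral_coe_eq_integral,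
        ENNReal.ofReal_toReal (BoundedContinuousFunction.lintegral_lt_top_of_nnreal _ _).ne]
    simp_rw [e]
    exact (continuous_integral_empiricalSpectralMeasure (by fun_prop)).measurable.ennreal_ofReal

/-- The empirical spectral measure as a kernel from the coordinates. -/
noncomputable def wignerKernel (N : ℕ) [NeZero N] : Kernel (WignerIndex N → ℝ) ℝ :=
  ⟨fun x => empiricalSpectralMeasure (wignerHermitian x), measurable_empiricalSpectralMeasure⟩

instance [NeZero N] : IsMarkovKernel (wignerKernel N) :=
  ⟨fun x => isProbabilityMeasure_empiricalSpectralMeasure (wignerHermitian x)⟩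

/-- The mean empirical spectral measure. -/
noncomputable def meanSpectralMeasure (N : ℕ) [NeZero N] : ProbabilityMeasure ℝ :=
  ⟨(wignerKernel N ∘ₖ Kernel.const Unit (gaussianPi (WignerIndex N))) (), inferInstance⟩

lemma integral_meanSpectralMeasure [NeZero N] {E : Type*} [NormedAddCommGroup E]
    [NormedSpace ℝ E] {g : ℝ → E} (hg : Integrable g (meanSpectralMeasure N : Measure ℝ)) :
    ∫ t, g t ∂(meanSpectralMeasure N : Measure ℝ) =
      ∫ x, (∫ t, g t ∂(empiricalSpectralMeasure (wignerHermitian x)))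
        ∂(gaussianPi (WignerIndex N)) := by
  rw [meanSpectralMeasure, ProbabilityMeasure.coe_mk] at hg ⊢
  rw [Kernel.integral_comp hg, Kernel.const_apply]
  rfl

lemma integral_inv_sub_empiricalSpectralMeasure {z : ℂ} (hz : 0 < z.im)
    (x : WignerIndex N → ℝ) :
    ∫ t : ℝ, (z - t)⁻¹ ∂(empiricalSpectralMeasure (wignerHermitian x)) =
      wignerStieltjes z x := by
  rw [integral_empiricalSpectralMeasure, wignerStieltjes, wignerResolvent,
    (wignerMatrix_isHermitian x).trace_resolvent_smul hz, Complex.real_smul]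
  push_cast
  simp only [div_eq_inv_mul]
  rfl

/-- The shift to `N + 1` avoids size 0, where the empirical measure is zero and not a probability
measure. -/
theorem tendsto_meanSpectralMeasure :
    Tendsto (fun N : ℕ => meanSpectralMeasure (N + 1)) atTop
      (𝓝 ⟨semicircleMeasure, isProbabilityMeasure_semicircleMeasure⟩) := by
  refine tendsto_of_tendsto_integral_inv_sub fun z hz => ?_
  obtain ⟨w, hw1, hw0, hwz, hwi⟩ := exists_norm_lt_one_add_inv hz
  rw [ProbabilityMeasure.coe_mk, integral_inv_sub_semicircleMeasure hz hw1 hw0 hwz]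
  have hs : w ^ 2 - z * w + 1 = 0 := by
    rw [← hwz]
    field_simp
    ring
  have h := (tendsto_add_atTop_iff_nat 1).2 (tendsto_integral_wignerStieltjes hz hs hwi)
  refine h.congr fun N => ?_
  rw [integral_meanSpectralMeasure]
  · simp_rw [integral_inv_sub_empiricalSpectralMeasure hz]
  · refine .of_bound (by fun_prop) (z.im)⁻¹ (.of_forall fun t => ?_)
    rw [norm_inv]
    gcongr
    refine le_trans ?_ (Complex.im_le_norm _)
    simp

lemma IsComplexWigner.hasLaw_wignerCoord {Ω : Type*} [MeasurableSpace Ω] {P : Measure Ω}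
    [IsProbabilityMeasure P] {X : Ω → HermitianMatrix N} (hX : IsComplexWigner X P) :
    HasLaw (fun ω => wignerCoord (X ω)) (gaussianPi (WignerIndex N)) P where
  aemeasurable := aemeasurable_pi_lambda _ fun c => (hX.hasLaw c).aemeasurable
  map_eq := by
    have h := (iIndepFun_iff_map_fun_eq_pi_map fun c => (hX.hasLaw c).aemeasurable).1 hX.indep
    simp_rw [(hX.hasLaw _).map_eq] at h
    exact h

end EmpiricalMeasure

/-! ### Transfer to the given random matrices. -/

theorem mainTheorem4 {Ω : Type*} [MeasurableSpace Ω] (P : Measure Ω) [IsProbabilityMeasure P]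
    (M : (N : ℕ) → Ω → HermitianMatrix N)
    (hM : ∀ N : ℕ, 1 ≤ N → IsComplexWigner (M N) P)
    (f : ℝ →ᵇ ℝ) :
    (∀ N : ℕ, 1 ≤ N →
      Integrable (fun ω => ∫ x, f x ∂(empiricalSpectralMeasure (M N ω))) P) ∧
    Tendsto (fun N : ℕ => ∫ ω, (∫ x, f x ∂(empiricalSpectralMeasure (M N ω))) ∂P) atTop
      (𝓝 (∫ x, f x ∂semicircleMeasure)) := by
  have hcont (N : ℕ) := continuous_integral_empiricalSpectralMeasure (N := N) f.continuous
  -- The matrix is recovered from its coordinates, so the statistic is a continuous function of a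
  -- standard Gaussian vector.
  have hcoord : ∀ N : ℕ, (fun ω => ∫ t, f t ∂(empiricalSpectralMeasure (M N ω))) =
      (fun x => ∫ t, f t ∂(empiricalSpectralMeasure (wignerHermitian x))) ∘
        fun ω => wignerCoord (M N ω) := fun N => by
    ext ω
    rw [Function.comp_apply, wignerHermitian_wignerCoord]
  constructor
  · intro N hN
    have : NeZero N := ⟨by omega⟩
    have hl := (hM N hN).hasLaw_wignerCoord
    refine .of_bound (C := ‖f‖) ?_ (.of_forall fun ω => ?_)
    · rw [hcoord N]
      exact ((hcont N).measurable.comp_aemeasurable hl.aemeasurable).aestronglyMeasurable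
    · have := isProbabilityMeasure_empiricalSpectralMeasure (M N ω)
      simpa using norm_integral_le_of_norm_le_const
        (μ := empiricalSpectralMeasure (M N ω)) (.of_forall f.norm_coe_le_norm)
  · rw [← tendsto_add_atTop_iff_nat 1]
    have h := (ProbabilityMeasure.tendsto_iff_forall_integral_tendsto.1
      tendsto_meanSpectralMeasure) f
    refine h.congr fun N => ?_
    have hl := (hM (N + 1) (by omega)).hasLaw_wignerCoord
    rw [integral_meanSpectralMeasure (f.integrable _), hcoord, hl.integral_comp
      (hcont (N + 1)).aestronglyMeasurable]
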